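/- **Notation.** $\mathbb N=\{1,2,\dots\}$, $\mathbb N_0=\mathbb N\cup\{0\}$. Let $s=\{\xi\in\mathbb C^{\mathbb N}: |\xi|_q:=(\sum_j|\xi_j|^2j^{2q})^{1/2}<\infty\ \text{for all } q\in\mathbb N_0\}$ with the topology given by the norms $|\cdot|_q$, and let $s'=\{\xi\in\mathbb C^{\mathbb N}: |\xi|'_q:=(\sum_j|\xi_j|^2j^{-2q})^{1/2}<\infty\ \text{for some } q\in\mathbb N_0\}$ with the locally convex inductive limit topology given by the norms $|\cdot|'_q$. Put $\langle\xi,\eta\rangle=\sum_j\xi_j\overline{\eta_j}$ for $(\xi,\eta)\in (s\times s')\cup(s'\times s)$. Let $\mathcal L(s',s)$ be the space of continuous linear operators $s'\to s$ with the topology of uniform convergence on bounded sets, with multiplication $xy=x\circ j\circ y$, where $j\colon s\hookrightarrow s'$ is the inclusion, and with the involution $x\mapsto x^*$ determined by $\langle x\xi,\eta\rangle=\langle \xi,x^*\eta\rangle$ (the hermitian adjoint on $\ell_2$). A sequence $(f_k)_{k\in\mathbb N}\subset s$ is orthonormal if $\langle f_k,f_l\rangle=\delta_{kl}$ for all $k,l$.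 For such a sequence let $\lambda^\infty(|f_k|_q)=\{\xi\in\mathbb C^{\mathbb N}:\sup_k|\xi_k|\,|f_k|_q<\infty\ \text{for all } q\in\mathbb N_0\}$ with the topology given by these seminorms and with pointwise multiplication and complex conjugation; $e_k$ denotes the $k$-th unit vector. An isomorphism of Fréchet ${}^*$-algebras is a ${}^*$-algebra isomorphism which is a homeomorphism. A projection is an element $P$ with $P=P^2=P^*$. The canonical Schauder basis of a closed commutative ${}^*$-subalgebra $E$ of $\mathcal L(s',s)$ consists of all minimal nonzero projections in $E$, i.e. of those nonzero projections $P\in E$ such that $Q=P$ for every nonzero projection $Q\in E$ with $QP=Q$. **Theorem.** (1) Every closed commutative ${}^*$-subalgebra of $\mathcal L(s',s)$ is isomorphic as a Fréchet ${}^*$-algebra to some closed ${}^*$-subalgebra of $\lambda^\infty(|f_k|_q)$ for some orthonormal sequence $(f_k)_{k\in\mathbb N}\subset s$. (2) More precisely, let $E$ be an infinite-dimensional closed commutative ${}^*$-subalgebra of $\mathcal L(s',s)$ whose canonical Schauder basis is $(\sum_{j\in\mathcal N_k}\langle\cdot,f_j\rangle f_j)_{k\in\mathbb N}$ (listed without repetition)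 for some family $(\mathcal N_k)_{k\in\mathbb N}$ of finite pairwise disjoint subsets of $\mathbb N$ and some orthonormal sequence $(f_j)_{j\in\mathbb N}\subset s$. Then there is an isomorphism of Fréchet ${}^*$-algebras from $E$ onto the closed ${}^*$-subalgebra of $\lambda^\infty(|f_k|_q)$ generated by $\{\sum_{j\in\mathcal N_k}e_j\}_{k\in\mathbb N}$ that maps $\sum_{j\in\mathcal N_k}\langle\cdot,f_j\rangle f_j$ to $\sum_{j\in\mathcal N_k}e_j$ for every $k\in\mathbb N$. (3) Conversely, if $(f_k)_{k\in\mathbb N}\subset s$ is an orthonormal sequence, then every closed ${}^*$-subalgebra of $\lambda^\infty(|f_k|_q)$ is isomorphic as a Fréchet ${}^*$-algebra to some closed commutative ${}^*$-subalgebra of $\mathcal L(s',s)$. -/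

import Mathlib

open scoped ComplexConjugate

noncomputable section

namespace SmoothOp

/-! ### Weighted `ℓ₂`-norms of complex sequences

Sequences are indexed by `ℕ = {0, 1, 2, …}`, so the weight of the `j`-th coordinate is `j + 1`. -/

/-- `∑ⱼ |ξⱼ|² (j+1)^{2p} < ∞`, for an integer exponent `p`. -/
def WMem (p : ℤ) (ξ : ℕ → ℂ) : Prop :=
  Summable fun j : ℕ => ‖ξ j‖ ^ 2 * ((j : ℝ) + 1) ^ (2 * p)

/-- `(∑ⱼ |ξⱼ|² (j+1)^{2p})^{1/2}`, for an integer exponent `p`. -/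
def wnorm (p : ℤ) (ξ : ℕ → ℂ) : ℝ :=
  √(∑' j : ℕ, ‖ξ j‖ ^ 2 * ((j : ℝ) + 1) ^ (2 * p))

/-- The pairing `⟨ξ, η⟩ = ∑ⱼ ξⱼ conj(ηⱼ)`. -/
def pairing (ξ η : ℕ → ℂ) : ℂ := ∑' j : ℕ, ξ j * conj (η j)

/-- The sequence `ξ` multiplied by the weight `(j+1)^p`. -/
def wseq (p : ℤ) (ξ : ℕ → ℂ) : ℕ → ℂ := fun j => ξ j * ((((j : ℝ) + 1) ^ p : ℝ) : ℂ)

theorem weight_pos (j : ℕ) : (0 : ℝ) < (j : ℝ) + 1 := by positivity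

theorem norm_wseq_sq (p : ℤ) (ξ : ℕ → ℂ) (j : ℕ) :
    ‖wseq p ξ j‖ ^ 2 = ‖ξ j‖ ^ 2 * ((j : ℝ) + 1) ^ (2 * p) := by
  have h := zpow_pos (weight_pos j) p
  rw [wseq, norm_mul, Complex.norm_real, Real.norm_of_nonneg h.le, mul_pow, mul_comm 2 p,
    zpow_mul]
  norm_cast

theorem wmem_iff (p : ℤ) (ξ : ℕ → ℂ) : WMem p ξ ↔ Memℓp (wseq p ξ) 2 := by
  rw [memℓp_gen_iff (by norm_num)]
  simp only [WMem, ENNReal.toReal_ofNat, Real.rpow_ofNat, norm_wseq_sq]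

theorem wnorm_eq {p : ℤ} {ξ : ℕ → ℂ} (h : WMem p ξ) :
    wnorm p ξ = ‖(⟨wseq p ξ, (wmem_iff p ξ).1 h⟩ : lp (fun _ : ℕ => ℂ) 2)‖ := by
  rw [lp.norm_eq_tsum_rpow (by norm_num), wnorm, Real.sqrt_eq_rpow]
  simp only [ENNReal.toReal_ofNat, Real.rpow_ofNat, norm_wseq_sq]

theorem wseq_add (p : ℤ) (ξ η : ℕ → ℂ) : wseq p (ξ + η) = wseq p ξ + wseq p η := by
  funext j; simp [wseq, add_mul]

theorem wseq_smul (p : ℤ) (c : ℂ) (ξ : ℕ → ℂ) : wseq p (c • ξ) = c • wseq p ξ := by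
  funext j; simp [wseq, mul_assoc]

theorem WMem.zero (p : ℤ) : WMem p 0 := by
  simp [WMem, summable_zero]

theorem WMem.add {p : ℤ} {ξ η : ℕ → ℂ} (hξ : WMem p ξ) (hη : WMem p η) : WMem p (ξ + η) := by
  rw [wmem_iff] at *
  rw [wseq_add]
  exact hξ.add hη

theorem WMem.smul {p : ℤ} {ξ : ℕ → ℂ} (c : ℂ) (hξ : WMem p ξ) : WMem p (c • ξ) := by
  rw [wmem_iff] at *
  rw [wseq_smul]
  exact hξ.const_smul c

theorem wnorm_nonneg (p : ℤ) (ξ : ℕ → ℂ) : 0 ≤ wnorm p ξ := Real.sqrt_nonneg _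

theorem wnorm_add_le {p : ℤ} {ξ η : ℕ → ℂ} (hξ : WMem p ξ) (hη : WMem p η) :
    wnorm p (ξ + η) ≤ wnorm p ξ + wnorm p η := by
  rw [wnorm_eq hξ, wnorm_eq hη, wnorm_eq (hξ.add hη)]
  refine le_trans (le_of_eq ?_) (norm_add_le _ _)
  congr 1
  exact Subtype.ext (wseq_add p ξ η)

theorem wnorm_smul (p : ℤ) (c : ℂ) (ξ : ℕ → ℂ) : wnorm p (c • ξ) = ‖c‖ * wnorm p ξ := by
  have : ∀ j : ℕ, ‖(c • ξ) j‖ ^ 2 * ((j : ℝ) + 1) ^ (2 * p)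
      = ‖c‖ ^ 2 * (‖ξ j‖ ^ 2 * ((j : ℝ) + 1) ^ (2 * p)) := fun j => by
    rw [Pi.smul_apply, smul_eq_mul, norm_mul]; ring
  simp only [wnorm, this, tsum_mul_left]
  rw [Real.sqrt_mul (by positivity), Real.sqrt_sq (norm_nonneg c)]

theorem weight_mono {p q : ℤ} (hpq : p ≤ q) (j : ℕ) :
    ((j : ℝ) + 1) ^ (2 * p) ≤ ((j : ℝ) + 1) ^ (2 * q) :=
  zpow_le_zpow_right₀ (by simp) (by lia)

theorem WMem.mono {p q : ℤ} (hpq : p ≤ q) {ξ : ℕ → ℂ} (h : WMem q ξ) : WMem p ξ := by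
  refine Summable.of_nonneg_of_le (fun j => ?_) (fun j => ?_) h
  · have := zpow_pos (weight_pos j) (2 * p); positivity
  · exact mul_le_mul_of_nonneg_left (weight_mono hpq j) (by positivity)

theorem wnorm_mono {p q : ℤ} (hpq : p ≤ q) {ξ : ℕ → ℂ} (h : WMem q ξ) :
    wnorm p ξ ≤ wnorm q ξ :=
  Real.sqrt_le_sqrt ((h.mono hpq).tsum_le_tsum
    (fun j => mul_le_mul_of_nonneg_left (weight_mono hpq j) (by positivity)) h)

theorem norm_apply_le {p : ℤ} {ξ : ℕ → ℂ} (h : WMem p ξ) (j : ℕ) :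
    ‖ξ j‖ * ((j : ℝ) + 1) ^ p ≤ wnorm p ξ := by
  have h1 := lp.norm_apply_le_norm (p := 2) (by norm_num)
    (⟨wseq p ξ, (wmem_iff p ξ).1 h⟩ : lp (fun _ : ℕ => ℂ) 2) j
  rw [← wnorm_eq h] at h1
  refine le_trans (le_of_eq ?_) h1
  change _ = ‖wseq p ξ j‖
  rw [wseq, norm_mul, Complex.norm_real, Real.norm_of_nonneg (zpow_pos (weight_pos j) p).le]

theorem wseq_mul_conj (p : ℤ) (ξ η : ℕ → ℂ) (j : ℕ) :
    wseq p ξ j * conj (wseq (-p) η j) = ξ j * conj (η j) := by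
  have h : (((((j : ℝ) + 1) ^ p : ℝ) : ℂ)) ≠ 0 := by
    exact_mod_cast (zpow_pos (weight_pos j) p).ne'
  simp only [wseq, map_mul, Complex.conj_ofReal]
  rw [zpow_neg, Complex.ofReal_inv]
  field_simp

theorem pairing_summable {p : ℤ} {ξ η : ℕ → ℂ} (hξ : WMem p ξ) (hη : WMem (-p) η) :
    Summable fun j => ξ j * conj (η j) := by
  have := lp.summable_inner (𝕜 := ℂ)
    (⟨wseq (-p) η, (wmem_iff _ η).1 hη⟩ : lp (fun _ : ℕ => ℂ) 2)
    (⟨wseq p ξ, (wmem_iff _ ξ).1 hξ⟩ : lp (fun _ : ℕ => ℂ) 2)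
  refine this.congr fun j => ?_
  rw [← wseq_mul_conj p ξ η j]
  rfl

theorem norm_pairing_le {p : ℤ} {ξ η : ℕ → ℂ} (hξ : WMem p ξ) (hη : WMem (-p) η) :
    ‖pairing ξ η‖ ≤ wnorm p ξ * wnorm (-p) η := by
  have := norm_inner_le_norm (𝕜 := ℂ)
    (⟨wseq (-p) η, (wmem_iff _ η).1 hη⟩ : lp (fun _ : ℕ => ℂ) 2)
    (⟨wseq p ξ, (wmem_iff _ ξ).1 hξ⟩ : lp (fun _ : ℕ => ℂ) 2)
  rw [lp.inner_eq_tsum, ← wnorm_eq hξ, ← wnorm_eq hη, mul_comm] at this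
  refine le_trans (le_of_eq ?_) this
  congr 1
  refine tsum_congr fun j => ?_
  rw [← wseq_mul_conj p ξ η j]
  rfl

theorem wmem_single (p : ℤ) (j : ℕ) : WMem p (Pi.single j 1) := by
  refine summable_of_ne_finset_zero (s := {j}) fun b hb => ?_
  rw [Pi.single_eq_of_ne (by simpa using hb)]
  simp

theorem wnorm_single (p : ℤ) (j : ℕ) : wnorm p (Pi.single j 1) = ((j : ℝ) + 1) ^ p := by
  rw [wnorm, tsum_eq_single j fun b hb => by rw [Pi.single_eq_of_ne hb]; simp]
  rw [Pi.single_eq_same, norm_one, one_pow, one_mul, mul_comm, zpow_mul]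
  exact Real.sqrt_sq (zpow_pos (weight_pos j) p).le

theorem pairing_single_right (ξ : ℕ → ℂ) (j : ℕ) : pairing ξ (Pi.single j 1) = ξ j := by
  rw [pairing, tsum_eq_single j fun b hb => by rw [Pi.single_eq_of_ne hb]; simp]
  simp

theorem pairing_conj (ξ η : ℕ → ℂ) : conj (pairing ξ η) = pairing η ξ := by
  rw [pairing, Complex.conj_tsum]
  exact tsum_congr fun j => by simp [mul_comm]

/-! ### The Fréchet space `s` of rapidly decreasing sequences -/

/-- The sequences `ξ` with `|ξ|_q < ∞` for all `q ∈ ℕ₀`. -/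
def sSubmodule : Submodule ℂ (ℕ → ℂ) where
  carrier := {ξ | ∀ q : ℕ, WMem q ξ}
  zero_mem' := fun q => WMem.zero q
  add_mem' := fun hξ hη q => (hξ q).add (hη q)
  smul_mem' := fun c _ hξ q => (hξ q).smul c

/-- The space `s`; a type of its own, so that it does not carry the topology of `ℂ^ℕ`. -/
def S : Type := sSubmodule

instance : AddCommGroup S := inferInstanceAs (AddCommGroup sSubmodule)
instance : Module ℂ S := inferInstanceAs (Module ℂ sSubmodule)

/-- The sequence of coordinates of an element of `s`. -/
def S.toSeq : S →ₗ[ℂ] (ℕ → ℂ) := sSubmodule.subtype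

instance : CoeFun S fun _ => ℕ → ℂ := ⟨fun ξ => S.toSeq ξ⟩

/-- The element of `s` with given coordinates. -/
def S.mk (ξ : ℕ → ℂ) (h : ∀ q : ℕ, WMem q ξ) : S := (⟨ξ, h⟩ : sSubmodule)

theorem S.toSeq_mk (ξ : ℕ → ℂ) (h : ∀ q : ℕ, WMem q ξ) : S.toSeq (S.mk ξ h) = ξ := rfl
theorem S.ext {ξ η : S} (h : ∀ j, ξ j = η j) : ξ = η := Subtype.ext (funext h)
theorem S.wmem_nat (ξ : S) (q : ℕ) : WMem q ξ := Subtype.prop (p := (· ∈ sSubmodule)) ξ q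
theorem S.wmem (ξ : S) (p : ℤ) : WMem p ξ := (ξ.wmem_nat p.toNat).mono (Int.self_le_toNat p)

/-- The norm `|ξ|_q = (∑ⱼ |ξⱼ|² (j+1)^{2q})^{1/2}` on `s`. -/
def sNorm : SeminormFamily ℂ S ℕ := fun q =>
  Seminorm.of (fun ξ => wnorm q ξ)
    (fun ξ η => by rw [map_add]; exact wnorm_add_le (ξ.wmem q) (η.wmem q))
    (fun c ξ => by rw [map_smul]; exact wnorm_smul q c ξ)

theorem sNorm_apply (q : ℕ) (ξ : S) : sNorm q ξ = wnorm q ξ := rfl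

/-- The topology of `s` is given by the norms `|·|_q`. -/
instance : TopologicalSpace S := sNorm.moduleFilterBasis.topology

theorem S.withSeminorms : WithSeminorms sNorm := ⟨rfl⟩

instance : IsTopologicalAddGroup S := S.withSeminorms.topologicalAddGroup
instance : ContinuousSMul ℂ S := S.withSeminorms.continuousSMul

/-! ### The dual `s'`: slowly increasing sequences with the inductive limit topology -/

/-- The sequences `ξ` with `|ξ|'_q < ∞` for some `q ∈ ℕ₀`. -/
def sDualSubmodule : Submodule ℂ (ℕ → ℂ) where
  carrier := {ξ | ∃ q : ℕ, WMem (-q) ξ}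
  zero_mem' := ⟨0, WMem.zero _⟩
  add_mem' := by
    rintro ξ η ⟨q, hξ⟩ ⟨r, hη⟩
    exact ⟨max q r, (hξ.mono (by simp)).add (hη.mono (by simp))⟩
  smul_mem' := by
    rintro c ξ ⟨q, hξ⟩
    exact ⟨q, hξ.smul c⟩

/-- The space `s'`; a type of its own, so that it does not carry the topology of `ℂ^ℕ`. -/
def SDual : Type := sDualSubmodule

instance : AddCommGroup SDual := inferInstanceAs (AddCommGroup sDualSubmodule)
instance : Module ℂ SDual := inferInstanceAs (Module ℂ sDualSubmodule)

/-- The sequence of coordinates of an element of `s'`. -/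
def SDual.toSeq : SDual →ₗ[ℂ] (ℕ → ℂ) := sDualSubmodule.subtype

instance : CoeFun SDual fun _ => ℕ → ℂ := ⟨fun ξ => SDual.toSeq ξ⟩

/-- The element of `s'` with given coordinates. -/
def SDual.mk (ξ : ℕ → ℂ) (h : ∃ q : ℕ, WMem (-q) ξ) : SDual := (⟨ξ, h⟩ : sDualSubmodule)

theorem SDual.toSeq_mk (ξ : ℕ → ℂ) (h : ∃ q : ℕ, WMem (-q) ξ) :
    SDual.toSeq (SDual.mk ξ h) = ξ := rfl
theorem SDual.ext {ξ η : SDual} (h : ∀ j, ξ j = η j) : ξ = η := Subtype.ext (funext h)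
theorem SDual.exists_wmem (ξ : SDual) : ∃ q : ℕ, WMem (-q) ξ :=
  Subtype.prop (p := (· ∈ sDualSubmodule)) ξ

/-- A seminorm on `s'` whose restriction to each step
`{ξ : |ξ|'_q < ∞}` is continuous for the norm `|ξ|'_q = (∑ⱼ |ξⱼ|² (j+1)^{-2q})^{1/2}`. -/
def StepBounded (p : Seminorm ℂ SDual) : Prop :=
  ∀ q : ℕ, ∃ C : ℝ, ∀ ξ : SDual, WMem (-q) ξ → p ξ ≤ C * wnorm (-q) ξ

theorem stepBounded_zero : StepBounded 0 := fun _ => ⟨0, fun _ _ => by simp⟩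

instance : Nonempty {p : Seminorm ℂ SDual // StepBounded p} := ⟨⟨0, stepBounded_zero⟩⟩

/-- All seminorms on `s'` that are continuous on every step. -/
def sDualSeminorms : SeminormFamily ℂ SDual {p : Seminorm ℂ SDual // StepBounded p} :=
  fun p => p.1

/-- The (locally convex) inductive limit topology of the steps `{ξ : |ξ|'_q < ∞}`, that is,
the finest locally convex topology that makes the inclusions of all steps continuous:
it is given by all seminorms whose restriction to every step is continuous. -/
instance : TopologicalSpace SDual := sDualSeminorms.moduleFilterBasis.topology

theorem SDual.withSeminorms : WithSeminorms sDualSeminorms := ⟨rfl⟩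

instance : IsTopologicalAddGroup SDual := SDual.withSeminorms.topologicalAddGroup
instance : ContinuousSMul ℂ SDual := SDual.withSeminorms.continuousSMul

/-- The unit vector `eⱼ`, as an element of `s`. -/
def S.unit (j : ℕ) : S := S.mk (Pi.single j 1) fun q => wmem_single q j

/-- The unit vector `eⱼ`, as an element of `s'`. -/
def SDual.unit (j : ℕ) : SDual := SDual.mk (Pi.single j 1) ⟨0, wmem_single _ j⟩

theorem SDual.toSeq_unit (j : ℕ) : SDual.toSeq (SDual.unit j) = Pi.single j 1 := rfl

/-! ### Continuous operators `s' → s` -/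

theorem stepBounded_comp_iff (T : SDual →ₗ[ℂ] S) :
    Continuous T ↔ ∀ q : ℕ, StepBounded ((sNorm q).comp T) := by
  constructor
  · intro hT q
    obtain ⟨s, C, -, hC⟩ := Seminorm.bound_of_continuous SDual.withSeminorms
      ((sNorm q).comp T) ((S.withSeminorms.continuous_seminorm q).comp hT)
    intro r
    have hs : ∃ D : ℝ, ∀ ξ : SDual, WMem (-r) ξ →
        s.sup sDualSeminorms ξ ≤ D * wnorm (-r) ξ := by
      classical
      clear hC
      induction s using Finset.induction_on with
      | empty => exact ⟨0, fun ξ _ => by simp⟩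
      | insert a s _ ih =>
        obtain ⟨D, hD⟩ := ih
        obtain ⟨D', hD'⟩ := a.2 r
        refine ⟨max D' D, fun ξ hξ => ?_⟩
        rw [Finset.sup_insert, Seminorm.sup_apply]
        refine max_le ((hD' ξ hξ).trans ?_) ((hD ξ hξ).trans ?_)
        · exact mul_le_mul_of_nonneg_right (le_max_left _ _) (wnorm_nonneg _ _)
        · exact mul_le_mul_of_nonneg_right (le_max_right _ _) (wnorm_nonneg _ _)
    obtain ⟨D, hD⟩ := hs
    refine ⟨C * D, fun ξ hξ => (hC ξ).trans ?_⟩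
    rw [smul_apply, NNReal.smul_def, smul_eq_mul, mul_assoc]
    exact mul_le_mul_of_nonneg_left (hD ξ hξ) C.2
  · intro h
    refine WithSeminorms.continuous_of_isBounded SDual.withSeminorms S.withSeminorms T fun q => ?_
    exact ⟨{⟨_, h q⟩}, 1, by simp [sDualSeminorms]⟩

/-- A linear map `s' → s` that is continuous on every step is continuous. -/
def mkCLM (T : SDual →ₗ[ℂ] S)
    (h : ∀ q r : ℕ, ∃ C : ℝ, ∀ ξ : SDual, WMem (-r) ξ → wnorm q (T ξ) ≤ C * wnorm (-r) ξ) :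
    SDual →L[ℂ] S :=
  ⟨T, (stepBounded_comp_iff T).2 h⟩

theorem bound_of_clm (x : SDual →L[ℂ] S) (q r : ℕ) :
    ∃ C : ℝ, 0 ≤ C ∧ ∀ ξ : SDual, WMem (-r) ξ → wnorm q (x ξ) ≤ C * wnorm (-r) ξ := by
  obtain ⟨C, hC⟩ := (stepBounded_comp_iff x.toLinearMap).1 x.continuous q r
  refine ⟨max C 0, le_max_right _ _, fun ξ hξ => (hC ξ hξ).trans ?_⟩
  exact mul_le_mul_of_nonneg_right (le_max_left _ _) (wnorm_nonneg _ _)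

/-- The continuous inclusion `j : s → s'`. -/
def incl : S →L[ℂ] SDual where
  toFun ξ := SDual.mk ξ ⟨0, ξ.wmem _⟩
  map_add' _ _ := rfl
  map_smul' _ _ := rfl
  cont := by
    let T : S →ₗ[ℂ] SDual :=
      { toFun := fun ξ => SDual.mk ξ ⟨0, ξ.wmem _⟩
        map_add' := fun _ _ => rfl
        map_smul' := fun _ _ => rfl }
    refine WithSeminorms.continuous_of_isBounded S.withSeminorms SDual.withSeminorms T fun p => ?_
    obtain ⟨C, hC⟩ := p.2 0
    refine ⟨{0}, C.toNNReal, fun ξ => ?_⟩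
    refine (hC (T ξ) (ξ.wmem _)).trans ?_
    rw [Finset.sup_singleton, smul_apply, NNReal.smul_def, smul_eq_mul]
    exact mul_le_mul_of_nonneg_right (Real.le_coe_toNNReal C) (wnorm_nonneg _ _)

theorem incl_apply (ξ : S) (j : ℕ) : incl ξ j = ξ j := rfl

theorem pairing_summable_ds (η : SDual) (ξ : S) : Summable fun j => η j * conj (ξ j) := by
  obtain ⟨q, hq⟩ := η.exists_wmem
  exact pairing_summable hq (ξ.wmem _)

theorem pairing_add_left (η η' : SDual) (ξ : S) :
    pairing (η + η' : SDual) ξ = pairing η ξ + pairing η' ξ := by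
  rw [pairing, pairing, pairing,
    ← (pairing_summable_ds η ξ).tsum_add (pairing_summable_ds η' ξ)]
  exact tsum_congr fun j => by rw [map_add, Pi.add_apply, add_mul]

theorem pairing_smul_left (c : ℂ) (η : SDual) (ξ : S) :
    pairing (c • η : SDual) ξ = c * pairing η ξ := by
  rw [pairing, pairing, ← tsum_mul_left]
  exact tsum_congr fun j => by rw [map_smul, Pi.smul_apply, smul_eq_mul, mul_assoc]

/-- The rank-one operator `⟨·, f⟩ f : s' → s` for `f ∈ s`. -/
def rankOne (f : S) : SDual →L[ℂ] S :=
  mkCLM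
    { toFun := fun ξ => pairing ξ f • f
      map_add' := fun ξ η => by rw [pairing_add_left, add_smul]
      map_smul' := fun c ξ => by rw [pairing_smul_left, mul_smul]; rfl }
    (fun q r => ⟨wnorm r f * wnorm q f, fun ξ hξ => by
      have h := norm_pairing_le hξ (by simpa using f.wmem r)
      rw [neg_neg] at h
      change wnorm q (S.toSeq (pairing ξ f • f)) ≤ _
      rw [map_smul, wnorm_smul]
      calc _ ≤ (wnorm (-r) ξ * wnorm r f) * wnorm q f :=
            mul_le_mul_of_nonneg_right h (wnorm_nonneg _ _)
        _ = _ := by ring⟩)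

/-! ### Multiplication and involution on `L(s', s)`

`L(s', s)` is `SDual →L[ℂ] S`. Mathlib's topology on this space is the topology of uniform
convergence on bounded sets. -/

/-- `xy = x ∘ j ∘ y`. -/
instance : Mul (SDual →L[ℂ] S) := ⟨fun x y => x.comp (incl.comp y)⟩

theorem mul_apply (x y : SDual →L[ℂ] S) (ξ : SDual) : (x * y) ξ = x (incl (y ξ)) := rfl

theorem L_mul_assoc (x y z : SDual →L[ℂ] S) : x * y * z = x * (y * z) :=
  ContinuousLinearMap.ext fun ξ => by rw [mul_apply, mul_apply, mul_apply, mul_apply]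

theorem L_mul_add (x y z : SDual →L[ℂ] S) : x * (y + z) = x * y + x * z :=
  ContinuousLinearMap.ext fun ξ => by
    rw [mul_apply, add_apply, map_add, map_add, add_apply, mul_apply, mul_apply]

theorem L_add_mul (x y z : SDual →L[ℂ] S) : (x + y) * z = x * z + y * z :=
  ContinuousLinearMap.ext fun ξ => by
    rw [mul_apply, add_apply, add_apply, mul_apply, mul_apply]

theorem L_zero_mul (x : SDual →L[ℂ] S) : 0 * x = 0 :=
  ContinuousLinearMap.ext fun ξ => by rw [mul_apply, zero_apply, zero_apply]

theorem L_mul_zero (x : SDual →L[ℂ] S) : x * 0 = 0 :=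
  ContinuousLinearMap.ext fun ξ => by rw [mul_apply, zero_apply, map_zero, map_zero]

theorem L_smul_mul (c : ℂ) (x y : SDual →L[ℂ] S) : (c • x) * y = c • (x * y) :=
  ContinuousLinearMap.ext fun ξ => by rw [mul_apply, smul_apply, smul_apply, mul_apply]

theorem L_mul_smul (c : ℂ) (x y : SDual →L[ℂ] S) : x * (c • y) = c • (x * y) :=
  ContinuousLinearMap.ext fun ξ => by
    rw [mul_apply, smul_apply, map_smul, map_smul, smul_apply, mul_apply]

instance : NonUnitalRing (SDual →L[ℂ] S) :=
  { (inferInstance : AddCommGroup (SDual →L[ℂ] S)) with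
    mul := (· * ·)
    left_distrib := L_mul_add
    right_distrib := L_add_mul
    zero_mul := L_zero_mul
    mul_zero := L_mul_zero
    mul_assoc := L_mul_assoc }

instance : IsScalarTower ℂ (SDual →L[ℂ] S) (SDual →L[ℂ] S) := ⟨L_smul_mul⟩

instance : SMulCommClass ℂ (SDual →L[ℂ] S) (SDual →L[ℂ] S) :=
  ⟨fun c x y => (L_mul_smul c x y).symm⟩

theorem functional_eq_zero (q : ℕ) (φ : SDual →ₗ[ℂ] ℂ) (C : ℝ)
    (hφ : ∀ ξ : SDual, WMem (-q) ξ → ‖φ ξ‖ ≤ C * wnorm (-q) ξ)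
    (h0 : ∀ j, φ (SDual.unit j) = 0) (ξ : SDual) (hξ : WMem (-q) ξ) : φ ξ = 0 := by
  have key : ∀ g : ℕ → ℂ, wseq (-q) (wseq q g) = g := fun g => by
    funext j
    have h : (((((j : ℝ) + 1) ^ (q : ℤ) : ℝ) : ℂ)) ≠ 0 := by
      exact_mod_cast (zpow_pos (weight_pos j) (q : ℤ)).ne'
    simp only [wseq]
    rw [zpow_neg, Complex.ofReal_inv]
    field_simp
  have hm : ∀ g : lp (fun _ : ℕ => ℂ) 2, WMem (-q) (wseq q g) := fun g => by
    rw [wmem_iff, key]; exact g.2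
  let L : lp (fun _ : ℕ => ℂ) 2 →ₗ[ℂ] SDual :=
    { toFun := fun g => SDual.mk (wseq q g) ⟨q, hm g⟩
      map_add' := fun g h => Subtype.ext (wseq_add q g h)
      map_smul' := fun c g => Subtype.ext (wseq_smul q c g) }
  have hL : ∀ g, wnorm (-q) (L g) = ‖g‖ := fun g => by
    change wnorm (-q) (wseq q g) = ‖g‖
    rw [wnorm_eq (hm g)]
    congr 1
    exact Subtype.ext (key g)
  let ψ : lp (fun _ : ℕ => ℂ) 2 →L[ℂ] ℂ := (φ ∘ₗ L).mkContinuous C fun g => by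
    have := hφ (L g) (hm g)
    rwa [hL] at this
  let g : lp (fun _ : ℕ => ℂ) 2 := ⟨wseq (-q) ξ, (wmem_iff _ _).1 hξ⟩
  have hg : L g = ξ := by
    refine SDual.ext fun j => ?_
    have h : (((((j : ℝ) + 1) ^ (q : ℤ) : ℝ) : ℂ)) ≠ 0 := by
      exact_mod_cast (zpow_pos (weight_pos j) (q : ℤ)).ne'
    change wseq q (wseq (-q) ξ) j = ξ j
    simp only [wseq]
    rw [zpow_neg, Complex.ofReal_inv]
    field_simp
  have hs := (lp.hasSum_single (p := 2) (by norm_num) g).mapL ψ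
  have hz : ∀ i, ψ (lp.single 2 i (g i)) = 0 := fun i => by
    change φ (L (lp.single 2 i (g i))) = 0
    have : L (lp.single 2 i (g i))
        = (g i * ((((i : ℝ) + 1) ^ (q : ℤ) : ℝ) : ℂ)) • SDual.unit i := by
      refine SDual.ext fun j => ?_
      change (lp.single 2 i (g i) : ℕ → ℂ) j * _ = _ * (Pi.single i (1 : ℂ) : ℕ → ℂ) j
      by_cases hij : j = i
      · subst hij; simp
      · simp [hij]
    rw [this, map_smul, h0, smul_zero]
  simp only [hz] at hs
  have h1 : ψ g = 0 := hs.unique hasSum_zero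
  have h2 : ψ g = φ ξ := by
    change φ (L g) = φ ξ
    rw [hg]
  rw [← h2, h1]

theorem adjoint_coord_bound (x : SDual →L[ℂ] S) (q r : ℕ) :
    ∃ C : ℝ, 0 ≤ C ∧ ∀ η : SDual, WMem (-r) η → ∀ j : ℕ,
      ‖pairing η (x (SDual.unit j))‖ ^ 2 * ((j : ℝ) + 1) ^ (2 * (q : ℤ))
        ≤ (C * wnorm (-r) η) ^ 2 * (1 / ((j : ℝ) + 1) ^ 2) := by
  obtain ⟨C, hC0, hC⟩ := bound_of_clm x r (q + 1)
  refine ⟨C, hC0, fun η hη j => ?_⟩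
  have h1 := norm_pairing_le hη ((x (SDual.unit j)).wmem _)
  have h2 := hC (SDual.unit j) (wmem_single _ j)
  change _ ≤ C * wnorm _ (Pi.single j 1) at h2
  rw [wnorm_single] at h2
  rw [neg_neg] at h1
  have h3 : ‖pairing η (x (SDual.unit j))‖
      ≤ C * wnorm (-r) η * ((j : ℝ) + 1) ^ (-((q + 1 : ℕ) : ℤ)) := by
    refine h1.trans ((mul_le_mul_of_nonneg_left h2 (wnorm_nonneg _ _)).trans (le_of_eq ?_))
    ring
  have h4 := zpow_pos (weight_pos j) (2 * (q : ℤ))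
  refine (mul_le_mul_of_nonneg_right (pow_le_pow_left₀ (norm_nonneg _) h3 2) h4.le).trans
    (le_of_eq ?_)
  rw [mul_pow, mul_assoc]
  congr 1
  have hj := (weight_pos j).ne'
  rw [← zpow_natCast, ← zpow_mul, ← zpow_add₀ hj, one_div, ← zpow_natCast, ← zpow_neg]
  congr 1
  push_cast
  ring

theorem summable_inv_weight : Summable fun j : ℕ => 1 / ((j : ℝ) + 1) ^ 2 := by
  have := (summable_nat_add_iff 1).2 (Real.summable_one_div_nat_pow.2 (one_lt_two))
  simpa using this

/-- The adjoint `x^*` on `s'`: its `j`-th coordinate is `(x^* η)ⱼ = ⟨η, x eⱼ⟩`. -/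
def adjointLin (x : SDual →L[ℂ] S) : SDual →ₗ[ℂ] S where
  toFun η := S.mk (fun j => pairing η (x (SDual.unit j))) fun q => by
    obtain ⟨r, hr⟩ := η.exists_wmem
    obtain ⟨C, -, hC⟩ := adjoint_coord_bound x q r
    refine Summable.of_nonneg_of_le (fun j => ?_) (fun j => hC η hr j)
      (summable_inv_weight.mul_left _)
    have := zpow_pos (weight_pos j) (2 * (q : ℤ))
    positivity
  map_add' η η' := S.ext fun _ => pairing_add_left _ _ _
  map_smul' c η := S.ext fun _ => pairing_smul_left _ _ _

theorem adjointLin_bound (x : SDual →L[ℂ] S) (q r : ℕ) :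
    ∃ C : ℝ, ∀ η : SDual, WMem (-r) η → wnorm q (adjointLin x η) ≤ C * wnorm (-r) η := by
  obtain ⟨C, hC0, hC⟩ := adjoint_coord_bound x q r
  refine ⟨C * √(∑' j : ℕ, 1 / ((j : ℝ) + 1) ^ 2), fun η hη => ?_⟩
  have h := ((adjointLin x η).wmem q).tsum_le_tsum (hC η hη) (summable_inv_weight.mul_left _)
  rw [tsum_mul_left] at h
  refine (Real.sqrt_le_sqrt h).trans (le_of_eq ?_)
  rw [Real.sqrt_mul (by positivity), Real.sqrt_sq (mul_nonneg hC0 (wnorm_nonneg _ _))]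
  ring

/-- The involution of `L(s', s)`. By `pairing_star` below, `⟨x ξ, η⟩ = ⟨ξ, x^* η⟩` for all
`ξ, η ∈ s'`, in particular for all `ξ, η ∈ ℓ₂`, so `x^*` is the hermitian adjoint of `x`. -/
instance : Star (SDual →L[ℂ] S) := ⟨fun x => mkCLM (adjointLin x) (adjointLin_bound x)⟩

theorem star_apply (x : SDual →L[ℂ] S) (η : SDual) (j : ℕ) :
    star x η j = pairing η (x (SDual.unit j)) := rfl

theorem pairing_star (x : SDual →L[ℂ] S) (ξ η : SDual) :
    pairing (x ξ) η = pairing ξ (star x η) := by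
  obtain ⟨q, hq⟩ := ξ.exists_wmem
  obtain ⟨r, hr⟩ := η.exists_wmem
  obtain ⟨C, hC0, hC⟩ := bound_of_clm x r q
  let φ : SDual →ₗ[ℂ] ℂ :=
    { toFun := fun ζ => conj (pairing η (x ζ)) - pairing ζ (star x η)
      map_add' := fun ζ ζ' => by
        rw [pairing_conj, pairing_conj, pairing_conj, pairing_add_left, map_add]
        have h : pairing (x ζ + x ζ' : S) η = pairing (x ζ) η + pairing (x ζ') η := by
          rw [pairing, pairing, pairing, ← Summable.tsum_add
            (pairing_summable ((x ζ).wmem r) hr) (pairing_summable ((x ζ').wmem r) hr)]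
          exact tsum_congr fun j => by rw [map_add, Pi.add_apply, add_mul]
        rw [h]; ring
      map_smul' := fun c ζ => by
        have h : pairing (c • x ζ : S) η = c * pairing (x ζ) η := by
          rw [pairing, pairing, ← tsum_mul_left]
          exact tsum_congr fun j => by rw [map_smul, Pi.smul_apply, smul_eq_mul, mul_assoc]
        rw [pairing_conj, pairing_conj, pairing_smul_left, map_smul, h]
        simp only [RingHom.id_apply, smul_eq_mul]
        ring }
  have h0 : φ ξ = 0 := by
    refine functional_eq_zero q φ (wnorm (-r) η * C + wnorm q (star x η)) ?_ ?_ ξ hq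
    · intro ζ hζ
      change ‖conj (pairing η (x ζ)) - pairing ζ (star x η)‖ ≤ _
      have h1 := norm_pairing_le hr ((x ζ).wmem _)
      have h2 := norm_pairing_le hζ ((star x η).wmem _)
      rw [neg_neg] at h1 h2
      have h3 := mul_le_mul_of_nonneg_left (hC ζ hζ) (wnorm_nonneg (-r) η)
      refine (norm_sub_le _ _).trans ?_
      rw [RCLike.norm_conj]
      nlinarith
    · intro j
      change conj (pairing η (x (SDual.unit j))) - pairing (Pi.single j 1) (star x η) = 0
      rw [← pairing_conj (star x η) (Pi.single j 1), pairing_single_right, star_apply, sub_self]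
  have h1 : conj (pairing η (x ξ)) - pairing ξ (star x η) = 0 := h0
  rwa [pairing_conj, sub_eq_zero] at h1

/-- `x` is determined by its pairings: `y = x^*` as soon as `⟨x ξ, η⟩ = ⟨ξ, y η⟩` for unit
vectors `ξ` and arbitrary `η`. -/
theorem eq_star_of_pairing {x y : SDual →L[ℂ] S}
    (h : ∀ (j : ℕ) (η : SDual), pairing (x (SDual.unit j)) η = pairing (SDual.unit j) (y η)) :
    y = star x := by
  ext1 η
  refine S.ext fun j => ?_
  have h1 := h j η
  change _ = pairing (Pi.single j 1) (y η) at h1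
  rw [← pairing_conj η, ← pairing_conj (y η), pairing_single_right] at h1
  rw [star_apply]
  exact ((starRingEnd ℂ).injective h1).symm

instance : StarRing (SDual →L[ℂ] S) where
  star_involutive x := by
    refine (eq_star_of_pairing fun j η => ?_).symm
    rw [← pairing_conj, ← pairing_star, pairing_conj]
  star_mul x y := by
    refine (eq_star_of_pairing fun j η => ?_).symm
    rw [mul_apply, mul_apply, pairing_star, ← pairing_star y]
    rfl
  star_add x y := by
    ext1 η
    refine S.ext fun j => ?_
    change pairing η (x (SDual.unit j) + y (SDual.unit j) : S)
      = pairing η (x (SDual.unit j)) + pairing η (y (SDual.unit j))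
    rw [pairing, pairing, pairing,
      ← (pairing_summable_ds η _).tsum_add (pairing_summable_ds η _)]
    exact tsum_congr fun i => by rw [map_add, Pi.add_apply, map_add, mul_add]

instance : StarModule ℂ (SDual →L[ℂ] S) where
  star_smul c x := by
    ext1 η
    refine S.ext fun j => ?_
    change pairing η (c • x (SDual.unit j) : S) = conj c * pairing η (x (SDual.unit j))
    rw [pairing, pairing, ← tsum_mul_left]
    exact tsum_congr fun i => by
      rw [map_smul, Pi.smul_apply, smul_eq_mul, map_mul]; ring

/-! ### Köthe matrices and Köthe algebras `λ^∞(A)` -/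

/-- A Köthe matrix `(a_{j,q})`. -/
structure KotheMatrix where
  /-- The entries `a_{j,q}`. -/
  entry : ℕ → ℕ → ℝ
  nonneg : ∀ j q, 0 ≤ entry j q
  exists_pos : ∀ j, ∃ q, 0 < entry j q
  mono : ∀ j q, entry j q ≤ entry j (q + 1)

/-- All entries are at least `1`; then `λ^∞(A)` is closed under pointwise multiplication. -/
class KotheMatrix.OneLE (A : KotheMatrix) : Prop where
  one_le : ∀ j q, 1 ≤ A.entry j q

/-- The sequences `ξ` with `sup_j |ξⱼ| a_{j,q} < ∞` for all `q`. -/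
def kotheSubmodule (A : KotheMatrix) : Submodule ℂ (ℕ → ℂ) where
  carrier := {ξ | ∀ q : ℕ, BddAbove (Set.range fun j => ‖ξ j‖ * A.entry j q)}
  zero_mem' := fun q => ⟨0, by rintro _ ⟨j, rfl⟩; simp⟩
  add_mem' := by
    intro ξ η hξ hη q
    obtain ⟨C, hC⟩ := hξ q
    obtain ⟨D, hD⟩ := hη q
    refine ⟨C + D, ?_⟩
    rintro _ ⟨j, rfl⟩
    have h1 := hC ⟨j, rfl⟩
    have h2 := hD ⟨j, rfl⟩
    have h3 := mul_le_mul_of_nonneg_right (norm_add_le (ξ j) (η j)) (A.nonneg j q)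
    simp only [Pi.add_apply] at *
    linarith
  smul_mem' := by
    intro c ξ hξ q
    obtain ⟨C, hC⟩ := hξ q
    refine ⟨‖c‖ * C, ?_⟩
    rintro _ ⟨j, rfl⟩
    have h1 := mul_le_mul_of_nonneg_left (hC ⟨j, rfl⟩) (norm_nonneg c)
    simp only [Pi.smul_apply, smul_eq_mul, norm_mul] at *
    linarith

/-- The Köthe space `λ^∞(A)`; a type of its own, so that it does not carry the topology of
`ℂ^ℕ`. -/
def KotheSpace (A : KotheMatrix) : Type := kotheSubmodule A

namespace KotheSpace

variable {A : KotheMatrix}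

instance : AddCommGroup (KotheSpace A) := inferInstanceAs (AddCommGroup (kotheSubmodule A))
instance : Module ℂ (KotheSpace A) := inferInstanceAs (Module ℂ (kotheSubmodule A))

/-- The sequence of coordinates of an element of `λ^∞(A)`. -/
def toSeq : KotheSpace A →ₗ[ℂ] (ℕ → ℂ) := (kotheSubmodule A).subtype

instance : CoeFun (KotheSpace A) fun _ => ℕ → ℂ := ⟨fun ξ => toSeq ξ⟩

/-- The element of `λ^∞(A)` with given coordinates. -/
def mk (ξ : ℕ → ℂ) (h : ∀ q : ℕ, BddAbove (Set.range fun j => ‖ξ j‖ * A.entry j q)) :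
    KotheSpace A := (⟨ξ, h⟩ : kotheSubmodule A)

theorem toSeq_mk (ξ : ℕ → ℂ)
    (h : ∀ q : ℕ, BddAbove (Set.range fun j => ‖ξ j‖ * A.entry j q)) :
    toSeq (mk ξ h) = ξ := rfl

theorem ext {ξ η : KotheSpace A} (h : ∀ j, ξ j = η j) : ξ = η := Subtype.ext (funext h)

theorem bddAbove (ξ : KotheSpace A) (q : ℕ) :
    BddAbove (Set.range fun j => ‖ξ j‖ * A.entry j q) :=
  Subtype.prop (p := (· ∈ kotheSubmodule A)) ξ q

theorem le_iSup (ξ : KotheSpace A) (q j : ℕ) :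
    ‖ξ j‖ * A.entry j q ≤ ⨆ i, ‖ξ i‖ * A.entry i q := le_ciSup (ξ.bddAbove q) j

variable (A) in
/-- The seminorms `|ξ|_{∞,q} = sup_j |ξⱼ| a_{j,q}` on `λ^∞(A)`. -/
def seminorms : SeminormFamily ℂ (KotheSpace A) ℕ := fun q =>
  Seminorm.of (fun ξ => ⨆ j, ‖ξ j‖ * A.entry j q)
    (fun ξ η => ciSup_le fun j => by
      have h1 := le_iSup ξ q j
      have h2 := le_iSup η q j
      have h3 := mul_le_mul_of_nonneg_right (norm_add_le (ξ j) (η j)) (A.nonneg j q)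
      rw [map_add, Pi.add_apply]
      linarith)
    (fun c ξ => by
      rw [Real.mul_iSup_of_nonneg (norm_nonneg c)]
      refine iSup_congr fun j => ?_
      rw [map_smul, Pi.smul_apply, smul_eq_mul, norm_mul, mul_assoc])

theorem seminorms_apply (q : ℕ) (ξ : KotheSpace A) :
    seminorms A q ξ = ⨆ j, ‖ξ j‖ * A.entry j q := rfl

/-- The topology of `λ^∞(A)` is given by the seminorms `|·|_{∞,q}`. -/
instance : TopologicalSpace (KotheSpace A) := (seminorms A).moduleFilterBasis.topology

theorem withSeminorms : WithSeminorms (seminorms A) := ⟨rfl⟩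

instance : IsTopologicalAddGroup (KotheSpace A) := withSeminorms.topologicalAddGroup
instance : ContinuousSMul ℂ (KotheSpace A) := withSeminorms.continuousSMul

/-- Pointwise multiplication. -/
instance [A.OneLE] : Mul (KotheSpace A) :=
  ⟨fun ξ η => mk (⇑ξ * ⇑η) fun q => by
    obtain ⟨C, hC⟩ := ξ.bddAbove q
    obtain ⟨D, hD⟩ := η.bddAbove q
    refine ⟨C * D, ?_⟩
    rintro _ ⟨j, rfl⟩
    have ha := KotheMatrix.OneLE.one_le (A := A) j q
    have h1 : ‖ξ j‖ * A.entry j q ≤ C := hC ⟨j, rfl⟩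
    have h2 : ‖η j‖ * A.entry j q ≤ D := hD ⟨j, rfl⟩
    have h3 : ‖ξ j‖ ≤ C := (le_mul_of_one_le_right (norm_nonneg _) ha).trans h1
    change ‖ξ j * η j‖ * A.entry j q ≤ C * D
    rw [norm_mul, mul_assoc]
    exact mul_le_mul h3 h2 (mul_nonneg (norm_nonneg _) (A.nonneg j q))
      ((norm_nonneg _).trans h3)⟩

theorem mul_apply [A.OneLE] (ξ η : KotheSpace A) (j : ℕ) : (ξ * η) j = ξ j * η j := rfl

instance [A.OneLE] : NonUnitalCommRing (KotheSpace A) :=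
  { (inferInstance : AddCommGroup (KotheSpace A)) with
    mul := (· * ·)
    left_distrib := fun ξ η ζ => ext fun j => mul_add (ξ j) (η j) (ζ j)
    right_distrib := fun ξ η ζ => ext fun j => add_mul (ξ j) (η j) (ζ j)
    zero_mul := fun ξ => ext fun j => zero_mul (ξ j)
    mul_zero := fun ξ => ext fun j => mul_zero (ξ j)
    mul_assoc := fun ξ η ζ => ext fun j => mul_assoc (ξ j) (η j) (ζ j)
    mul_comm := fun ξ η => ext fun j => mul_comm (ξ j) (η j) }

instance [A.OneLE] : IsScalarTower ℂ (KotheSpace A) (KotheSpace A) :=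
  ⟨fun c ξ η => ext fun j => mul_assoc c (ξ j) (η j)⟩

instance [A.OneLE] : SMulCommClass ℂ (KotheSpace A) (KotheSpace A) :=
  ⟨fun c ξ η => ext fun j => (mul_left_comm (ξ j) c (η j)).symm⟩

/-- Pointwise conjugation. -/
instance : Star (KotheSpace A) :=
  ⟨fun ξ => mk (fun j => conj (ξ j)) fun q => by simpa using ξ.bddAbove q⟩

theorem star_apply (ξ : KotheSpace A) (j : ℕ) : star ξ j = conj (ξ j) := rfl

instance [A.OneLE] : StarRing (KotheSpace A) where
  star_involutive ξ := ext fun j => Complex.conj_conj (ξ j)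
  star_mul ξ η := ext fun j => by
    rw [star_apply, mul_apply, mul_apply, star_apply, star_apply, map_mul, mul_comm]
  star_add ξ η := ext fun j => map_add (starRingEnd ℂ) (ξ j) (η j)

instance [A.OneLE] : StarModule ℂ (KotheSpace A) where
  star_smul c ξ := ext fun j => map_mul (starRingEnd ℂ) c (ξ j)

variable (A) in
/-- The unit vector `eⱼ`, as an element of `λ^∞(A)`. -/
def unit (j : ℕ) : KotheSpace A :=
  mk (Pi.single j 1) fun q => ⟨A.entry j q, by
    rintro _ ⟨i, rfl⟩
    by_cases h : i = j
    · subst h; simp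
    · simp [h, A.nonneg j q]⟩

end KotheSpace

/-! ### Orthonormal sequences in `s` and the algebras `λ^∞(|f_k|_q)` -/

/-- `(f_k)` is an orthonormal sequence of `ℓ₂` whose elements belong to `s`. -/
def OrthonormalSeq (f : ℕ → S) : Prop :=
  ∀ i j, pairing (f i) (f j) = if i = j then 1 else 0

theorem OrthonormalSeq.wnorm_zero {f : ℕ → S} (hf : OrthonormalSeq f) (k : ℕ) :
    wnorm 0 (f k) = 1 := by
  have h := hf k k
  rw [if_pos rfl, pairing] at h
  have h2 : ∑' j : ℕ, f k j * conj (f k j)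
      = ((∑' j : ℕ, ‖f k j‖ ^ 2 * ((j : ℝ) + 1) ^ (2 * (0 : ℤ)) : ℝ) : ℂ) := by
    rw [Complex.ofReal_tsum]
    exact tsum_congr fun j => by simp [Complex.mul_conj, Complex.normSq_eq_norm_sq]
  rw [h2] at h
  rw [wnorm, Complex.ofReal_eq_one.1 h, Real.sqrt_one]

theorem OrthonormalSeq.one_le {f : ℕ → S} (hf : OrthonormalSeq f) (k q : ℕ) :
    1 ≤ sNorm q (f k) := by
  rw [← hf.wnorm_zero k]
  exact wnorm_mono (by positivity) ((f k).wmem q)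

/-- The Köthe matrix `(|f_k|_q)_{k,q}` of an orthonormal sequence `(f_k)` in `s`. -/
def normMatrix (f : ℕ → S) (hf : OrthonormalSeq f) : KotheMatrix where
  entry k q := sNorm q (f k)
  nonneg _ _ := apply_nonneg _ _
  exists_pos k := ⟨0, one_pos.trans_le (hf.one_le k 0)⟩
  mono k q := wnorm_mono (by simp) ((f k).wmem _)

instance (f : ℕ → S) (hf : OrthonormalSeq f) : (normMatrix f hf).OneLE := ⟨hf.one_le⟩

/-! ### Closed `*`-subalgebras, canonical Schauder bases, isomorphisms -/

/-- The closed `*`-subalgebra generated by `Z`: the smallest closed `*`-subalgebra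
containing `Z`. -/
def closedAdjoin {B : Type*} [NonUnitalRing B] [Module ℂ B] [IsScalarTower ℂ B B]
    [SMulCommClass ℂ B B] [StarRing B] [StarModule ℂ B] [TopologicalSpace B] (Z : Set B) :
    NonUnitalStarSubalgebra ℂ B :=
  sInf {F | IsClosed (F : Set B) ∧ Z ⊆ F}

section Algebra

variable {B C : Type*} [NonUnitalRing B] [Module ℂ B] [StarRing B]
  [NonUnitalRing C] [Module ℂ C] [StarRing C]

/-- A nonzero projection of the `*`-algebra `E` that is minimal among the nonzero projections
of `E` (for the order `Q ≤ P ↔ Q P = Q`). -/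
structure IsMinimalProjection (E : NonUnitalStarSubalgebra ℂ B) (P : B) : Prop where
  mem : P ∈ E
  isStarProjection : IsStarProjection P
  ne_zero : P ≠ 0
  eq_of_le : ∀ Q ∈ E, IsStarProjection Q → Q ≠ 0 → Q * P = Q → Q = P

/-- The sequence `(P_k)` enumerates, without repetition, all nonzero minimal projections
of `E`; for a closed commutative `*`-subalgebra `E` of `L(s', s)` this is what is called its
canonical Schauder basis. -/
structure IsCanonicalBasis (E : NonUnitalStarSubalgebra ℂ B) (P : ℕ → B) : Prop where
  injective : Function.Injective P
  range_eq : Set.range P = {Q | IsMinimalProjection E Q}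

theorem IsCanonicalBasis.mem {E : NonUnitalStarSubalgebra ℂ B} {P : ℕ → B}
    (h : IsCanonicalBasis E P) (k : ℕ) : P k ∈ E := by
  have : P k ∈ {Q | IsMinimalProjection E Q} := h.range_eq ▸ Set.mem_range_self k
  exact this.mem

/-- Isomorphism as Fréchet `*`-algebras: a `*`-algebra isomorphism that is a homeomorphism. -/
def FrechetIso [TopologicalSpace B] [TopologicalSpace C] (E : NonUnitalStarSubalgebra ℂ B)
    (F : NonUnitalStarSubalgebra ℂ C) : Prop :=
  ∃ Φ : E ≃⋆ₐ[ℂ] F, Continuous Φ ∧ Continuous Φ.symm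

end Algebra

end SmoothOp
end

/-!
An operator `x : s' → s` induces a compact operator on `ℓ₂`, since its range there is bounded for
the norm `|·|₁`. Hence a commutative `*`-subalgebra `E` of `L(s', s)` becomes a commuting family of
compact operators that is closed under adjoints, and it has a maximal orthonormal system of joint
eigenvectors, on whose orthogonal complement it vanishes. An eigenvector with a nonzero eigenvalue
is in the range of an operator of `E`, so it belongs to `s`; those annihilated by `E` can be taken
from `s` as well. So `E` consists of diagonal operators `∑ⱼ ξⱼ ⟨·, fⱼ⟩ fⱼ` for an orthonormal
sequence `(f_k)` in `s`.

The map `ξ ↦ ∑ⱼ ξⱼ ⟨·, fⱼ⟩ fⱼ` is a `*`-homomorphism of `λ^∞(|f_k|_q)` onto a closed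
`*`-subalgebra of `L(s', s)`, and a homeomorphism onto its range: convergence rests on
`|f_k|_q⁴ ≤ |f_k|_{4q}`, which follows from Cauchy–Schwarz, and on `∑ₖ |f_k|₁⁻² < ∞`. This gives the
correspondence between closed `*`-subalgebras.

Finally, `λ^∞(|f_k|_q)` is a Schwartz space, so its projections are the indicators of finite sets,
and every closed `*`-subalgebra is generated by its minimal projections: the coordinates of largest
modulus of an element `ξ` form a set whose indicator is the limit of the powers of a multiple of
`ξ* ξ`, and peeling these off exhausts `ξ`. Hence `E` is the closed `*`-algebra generated by its
canonical Schauder basis, and any orthonormal sequence that diagonalizes this basis diagonalizes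
`E`.
-/

open scoped ComplexConjugate

noncomputable section

namespace SmoothOp

/-! ### Generated closed `*`-subalgebras and `*`-homomorphisms -/

section ClosedAdjoin

variable {B C : Type*}
  [NonUnitalRing B] [Module ℂ B] [IsScalarTower ℂ B B] [SMulCommClass ℂ B B] [StarRing B]
  [StarModule ℂ B] [TopologicalSpace B]
  [NonUnitalRing C] [Module ℂ C] [IsScalarTower ℂ C C] [SMulCommClass ℂ C C] [StarRing C]
  [StarModule ℂ C] [TopologicalSpace C]

theorem subset_closedAdjoin (Z : Set B) : Z ⊆ closedAdjoin Z := fun _ hz =>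
  NonUnitalStarAlgebra.mem_sInf.2 fun _ hF => hF.2 hz

theorem isClosed_closedAdjoin (Z : Set B) : IsClosed (closedAdjoin Z : Set B) := by
  rw [closedAdjoin, NonUnitalStarAlgebra.coe_sInf]
  exact isClosed_biInter fun F hF => hF.1

theorem closedAdjoin_le {Z : Set B} {F : NonUnitalStarSubalgebra ℂ B}
    (hF : IsClosed (F : Set B)) (hZ : Z ⊆ F) : closedAdjoin Z ≤ F :=
  sInf_le ⟨hF, hZ⟩

theorem map_closedAdjoin {φ : B →⋆ₙₐ[ℂ] C} (hφ : Continuous φ) (hφ' : IsClosedMap φ) (Z : Set B) :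
    (closedAdjoin Z).map φ = closedAdjoin (φ '' Z) := by
  refine le_antisymm (NonUnitalStarSubalgebra.map_le.2 (closedAdjoin_le ?_ ?_))
    (closedAdjoin_le ?_ (Set.image_mono (subset_closedAdjoin Z)))
  · exact (isClosed_closedAdjoin _).preimage hφ
  · exact fun z hz => subset_closedAdjoin _ (Set.mem_image_of_mem φ hz)
  · exact hφ' _ (isClosed_closedAdjoin Z)

end ClosedAdjoin

section Map

variable {B C : Type*} [NonUnitalRing B] [Module ℂ B] [StarRing B]
  [NonUnitalRing C] [Module ℂ C] [StarRing C] {φ : B →⋆ₙₐ[ℂ] C}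

theorem isStarProjection_map_iff (hφ : Function.Injective φ) {P : B} :
    IsStarProjection (φ P) ↔ IsStarProjection P := by
  simp only [isStarProjection_iff', ← map_mul, ← map_star, hφ.eq_iff]

theorem isMinimalProjection_map_iff (hφ : Function.Injective φ)
    {F : NonUnitalStarSubalgebra ℂ B} {P : B} :
    IsMinimalProjection (F.map φ) (φ P) ↔ IsMinimalProjection F P := by
  have hmem : ∀ Q, φ Q ∈ F.map φ ↔ Q ∈ F := fun Q => hφ.mem_set_image
  constructor
  · rintro ⟨h₁, h₂, h₃, h₄⟩
    refine ⟨(hmem P).1 h₁, (isStarProjection_map_iff hφ).1 h₂, fun h => h₃ (h ▸ map_zero φ), ?_⟩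
    intro Q hQ hQ' hQ₀ hQP
    exact hφ (h₄ (φ Q) ((hmem Q).2 hQ) ((isStarProjection_map_iff hφ).2 hQ')
      ((map_ne_zero_iff φ hφ).2 hQ₀) (by rw [← map_mul, hQP]))
  · rintro ⟨h₁, h₂, h₃, h₄⟩
    refine ⟨(hmem P).2 h₁, (isStarProjection_map_iff hφ).2 h₂, (map_ne_zero_iff φ hφ).2 h₃, ?_⟩
    rintro _ ⟨Q, hQ, rfl⟩ hQ' hQ₀ hQP
    exact congrArg φ (h₄ Q hQ ((isStarProjection_map_iff hφ).1 hQ')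
      ((map_ne_zero_iff φ hφ).1 hQ₀) (hφ (by rw [map_mul]; exact hQP)))

theorem setOf_isMinimalProjection_map (hφ : Function.Injective φ)
    (F : NonUnitalStarSubalgebra ℂ B) :
    {P | IsMinimalProjection (F.map φ) P} = φ '' {P | IsMinimalProjection F P} := by
  ext P
  constructor
  · intro hP
    obtain ⟨Q, -, rfl⟩ := hP.mem
    exact ⟨Q, (isMinimalProjection_map_iff hφ).1 hP, rfl⟩
  · rintro ⟨Q, hQ, rfl⟩
    exact (isMinimalProjection_map_iff hφ).2 hQ

/-- The `*`-isomorphism of a `*`-subalgebra onto its image under an injective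
`*`-homomorphism. -/
def mapEquiv (hφ : Function.Injective φ) (F : NonUnitalStarSubalgebra ℂ B) :
    F ≃⋆ₐ[ℂ] F.map φ where
  __ := Equiv.Set.image φ F hφ
  map_mul' x y := Subtype.ext (map_mul φ x.1 y.1)
  map_add' x y := Subtype.ext (map_add φ x.1 y.1)
  map_star' x := Subtype.ext (map_star φ x.1)
  map_smul' c x := Subtype.ext (map_smul φ c x.1)

theorem coe_mapEquiv (hφ : Function.Injective φ) (F : NonUnitalStarSubalgebra ℂ B) (x : F) :
    (mapEquiv hφ F x : C) = φ x := rfl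

theorem coe_mapEquiv_symm_eq (hφ : Function.Injective φ) {F : NonUnitalStarSubalgebra ℂ B}
    {y : F.map φ} {b : B} (h : φ b = y) : ((mapEquiv hφ F).symm y : B) = b :=
  hφ <| by rw [← coe_mapEquiv hφ, StarAlgEquiv.apply_symm_apply, h]

variable [TopologicalSpace B] [TopologicalSpace C]

theorem continuous_mapEquiv (hφ : Topology.IsEmbedding φ) (F : NonUnitalStarSubalgebra ℂ B) :
    Continuous (mapEquiv hφ.injective F) :=
  (hφ.continuous.comp continuous_subtype_val).subtype_mk _

theorem continuous_mapEquiv_symm (hφ : Topology.IsEmbedding φ)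
    (F : NonUnitalStarSubalgebra ℂ B) : Continuous (mapEquiv hφ.injective F).symm := by
  refine (hφ.isInducing.comp Topology.IsInducing.subtypeVal).continuous_iff.2
    (continuous_subtype_val.congr fun x => ?_)
  rw [Function.comp_apply, Function.comp_apply, ← coe_mapEquiv hφ.injective,
    StarAlgEquiv.apply_symm_apply]

theorem frechetIso_map (hφ : Topology.IsEmbedding φ) (F : NonUnitalStarSubalgebra ℂ B) :
    FrechetIso F (F.map φ) :=
  ⟨mapEquiv hφ.injective F, continuous_mapEquiv hφ F, continuous_mapEquiv_symm hφ F⟩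

theorem FrechetIso.symm {E : NonUnitalStarSubalgebra ℂ B} {F : NonUnitalStarSubalgebra ℂ C}
    (h : FrechetIso E F) : FrechetIso F E := by
  obtain ⟨Φ, hΦ, hΦ'⟩ := h
  exact ⟨Φ.symm, hΦ', hΦ⟩

end Map

theorem commute_of_mem_map {B C : Type*} [NonUnitalCommRing B] [Module ℂ B] [StarRing B]
    [NonUnitalRing C] [Module ℂ C] [StarRing C] {φ : B →⋆ₙₐ[ℂ] C}
    {F : NonUnitalStarSubalgebra ℂ B} : ∀ x ∈ F.map φ, ∀ y ∈ F.map φ, x * y = y * x := by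
  rintro _ ⟨b, -, rfl⟩ _ ⟨c, -, rfl⟩
  exact (Commute.all b c).map φ

/-! ### Joint eigenvectors of commuting compact operators -/

theorem exists_jointEigenvector {𝕜 V ι : Type*} [Field 𝕜] [IsAlgClosed 𝕜] [AddCommGroup V]
    [Module 𝕜 V] [FiniteDimensional 𝕜 V] [Nontrivial V] (T : ι → Module.End 𝕜 V)
    (hT : ∀ i j, Commute (T i) (T j)) : ∃ v ≠ 0, ∀ i, ∃ c : 𝕜, T i v = c • v := by
  let 𝓚 : Set (Submodule 𝕜 V) := {K | K ≠ ⊥ ∧ ∀ i, ∀ v ∈ K, T i v ∈ K}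
  obtain ⟨K, ⟨hK, hinv⟩, hmin⟩ := wellFounded_lt.has_min 𝓚
    ⟨⊤, top_ne_bot, fun _ _ _ => Submodule.mem_top⟩
  obtain ⟨v, hv, hv0⟩ := K.ne_bot_iff.1 hK
  refine ⟨v, hv0, fun i => ?_⟩
  have : Nontrivial K := Submodule.nontrivial_iff_ne_bot.2 hK
  obtain ⟨c, hc⟩ := Module.End.exists_eigenvalue ((T i).restrict (hinv i))
  obtain ⟨w, hw⟩ := hc.exists_hasEigenvector
  have hne : K ⊓ (T i).eigenspace c ≠ ⊥ := (Submodule.ne_bot_iff _).2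
    ⟨w, ⟨w.2, Module.End.mem_eigenspace_iff.2 (congrArg Subtype.val hw.apply_eq_smul)⟩,
      fun h => hw.2 (Subtype.ext h)⟩
  have heq : K ⊓ (T i).eigenspace c = K := inf_le_left.eq_of_not_lt <| hmin _
    ⟨hne, fun j u hu =>
      ⟨hinv j u hu.1, Module.End.mapsTo_genEigenspace_of_comm (hT i j) c 1 hu.2⟩⟩
  exact ⟨c, Module.End.mem_eigenspace_iff.1 (heq.ge hv).2⟩

section Hilbert

variable {𝕜 H : Type*} [RCLike 𝕜] [NormedAddCommGroup H] [InnerProductSpace 𝕜 H]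

theorem mem_orthogonal_span_iff {V : Set H} {w : H} :
    w ∈ (Submodule.span 𝕜 V)ᗮ ↔ ∀ v ∈ V, inner 𝕜 v w = 0 := by
  rw [← Submodule.span_singleton_le_iff_mem, ← Submodule.isOrtho_iff_le, Submodule.isOrtho_comm,
    Submodule.isOrtho_span]
  simp only [Set.mem_singleton_iff, forall_eq]

theorem orthonormal_insert {V : Set H} (hV : Orthonormal 𝕜 ((↑) : V → H)) {w : H} (hw : ‖w‖ = 1)
    (hwV : ∀ v ∈ V, inner 𝕜 v w = 0) : Orthonormal 𝕜 ((↑) : ↑(insert w V) → H) := by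
  refine ⟨?_, ?_⟩
  · rintro ⟨v, rfl | hv⟩
    exacts [hw, hV.1 ⟨v, hv⟩]
  · rintro ⟨u, rfl | hu⟩ ⟨v, rfl | hv⟩ huv
    · exact absurd rfl huv
    · exact inner_eq_zero_symm.1 (hwV v hv)
    · exact hwV u hu
    · exact hV.2 (i := ⟨u, hu⟩) (j := ⟨v, hv⟩) fun h =>
        huv (Subtype.mk_eq_mk.2 (Subtype.mk_eq_mk.1 h))

theorem exists_orthonormal_subset_maximal {P : Set H} (hP : ∀ (c : 𝕜), ∀ x ∈ P, c • x ∈ P) :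
    ∃ V ⊆ P, Orthonormal 𝕜 ((↑) : V → H) ∧
      ∀ x ∈ P, (∀ v ∈ V, inner 𝕜 v x = 0) → x = 0 := by
  obtain ⟨V, hV⟩ := zorn_subset {V : Set H | V ⊆ P ∧ Orthonormal 𝕜 ((↑) : V → H)} fun c hc hcc =>
    ⟨⋃₀ c, ⟨Set.sUnion_subset fun V hV => (hc hV).1,
      orthonormal_sUnion_of_directed hcc.directedOn fun V hV => (hc hV).2⟩,
      fun _ => Set.subset_sUnion_of_mem⟩
  refine ⟨V, hV.prop.1, hV.prop.2, fun x hx hxV => ?_⟩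
  by_contra hx0
  let w : H := ((‖x‖⁻¹ : ℝ) : 𝕜) • x
  have hw : ‖w‖ = 1 := by
    rw [norm_smul, RCLike.norm_ofReal, abs_inv, abs_norm, inv_mul_cancel₀ (norm_ne_zero_iff.2 hx0)]
  have hwV : ∀ v ∈ V, inner 𝕜 v w = 0 := fun v hv => by rw [inner_smul_right, hxV v hv, mul_zero]
  have hwmem : w ∈ V := hV.le_of_ge ⟨Set.insert_subset (hP _ x hx) hV.prop.1,
    orthonormal_insert hV.prop.2 hw hwV⟩ (Set.subset_insert w V) (Set.mem_insert w V)
  exact norm_ne_zero_iff.1 (hw ▸ one_ne_zero) (inner_self_eq_zero.1 (hwV w hwmem))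

theorem countable_of_orthonormal {ι κ : Type*} [Countable κ] {v : ι → H} (hv : Orthonormal 𝕜 v)
    (e : κ → H) (he : ∀ x : H, (∀ k, inner 𝕜 x (e k) = 0) → x = 0) : Countable ι := by
  rw [← Set.countable_univ_iff]
  refine (Set.countable_iUnion fun k =>
    (hv.inner_products_summable (e k)).countable_support).mono fun i _ => ?_
  obtain ⟨k, hk⟩ := not_forall.1 (mt (he (v i)) (hv.ne_zero i))
  exact Set.mem_iUnion.2 ⟨k, pow_ne_zero 2 (norm_ne_zero_iff.2 hk)⟩

theorem exists_ne_zero_forall_inner_eq_zero {M : Type*} [AddCommGroup M] [Module 𝕜 M]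
    (hM : ¬ Module.Finite 𝕜 M) (T : M →ₗ[𝕜] H) {V : Set H} (hV : V.Finite) :
    ∃ u ≠ 0, ∀ v ∈ V, inner 𝕜 v (T u) = 0 := by
  by_contra! h
  have := hV.to_subtype
  let A : M →ₗ[𝕜] V → 𝕜 := LinearMap.pi fun v => innerₛₗ 𝕜 v.1 ∘ₗ T
  refine hM (Module.Finite.of_injective A ((injective_iff_map_eq_zero A).2 fun u hu => ?_))
  by_contra hu0
  obtain ⟨v, hv, hne⟩ := h u hu0
  exact hne (congrFun hu ⟨v, hv⟩)

theorem apply_mem_orthogonal_of_star_eigenvectors [CompleteSpace H] {A : H →L[𝕜] H} {V : Set H}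
    (hV : ∀ v ∈ V, ∃ c : 𝕜, star A v = c • v) :
    ∀ w ∈ (Submodule.span 𝕜 V)ᗮ, A w ∈ (Submodule.span 𝕜 V)ᗮ := by
  simp only [mem_orthogonal_span_iff]
  intro w hw v hv
  obtain ⟨c, hc⟩ := hV v hv
  rw [← ContinuousLinearMap.adjoint_inner_left, ← ContinuousLinearMap.star_eq_adjoint, hc,
    inner_smul_left, hw v hv, mul_zero]

end Hilbert

section Spectral

variable {H : Type*} [NormedAddCommGroup H] [InnerProductSpace ℂ H] [CompleteSpace H]

theorem exists_jointEigenvector_of_isCompactOperator {ι : Type*} {A : H →L[ℂ] H}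
    (hA : IsCompactOperator A) (hA' : A.IsSymmetric) (hA₀ : A ≠ 0) (T : ι → Module.End ℂ H)
    (hTA : ∀ i, Commute A.toLinearMap (T i)) (hT : ∀ i j, Commute (T i) (T j)) :
    ∃ v, A v ≠ 0 ∧ ∀ i, ∃ c : ℂ, T i v = c • v := by
  have hne := mt (A.eq_zero_of_forall_hasEigenvalue_eq_zero hA hA').1 hA₀
  push Not at hne
  obtain ⟨μ, hμ, hμ₀⟩ := hne
  let K := Module.End.eigenspace A.toLinearMap μ
  have : FiniteDimensional ℂ K := A.finite_dimensional_eigenspace hA μ hμ₀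
  have : Nontrivial K := Submodule.nontrivial_iff_ne_bot.2 hμ
  obtain ⟨v, hv₀, hv⟩ := exists_jointEigenvector
    (fun i => (T i).restrict (Module.End.mapsTo_genEigenspace_of_comm (hTA i) μ 1))
    fun i j => LinearMap.ext fun u => Subtype.ext (LinearMap.congr_fun (hT i j) u.1)
  have hAv : A v = μ • (v : H) := Module.End.mem_eigenspace_iff.1 v.2
  refine ⟨v, ?_, fun i => (hv i).imp fun c hc => congrArg Subtype.val hc⟩
  rw [hAv]
  exact smul_ne_zero hμ₀ fun h => hv₀ (Subtype.ext h)

variable {𝒜 : Set (H →L[ℂ] H)}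

theorem exists_jointEigenvector_mem (hcpt : ∀ A ∈ 𝒜, IsCompactOperator A)
    (hcomm : ∀ A ∈ 𝒜, ∀ B ∈ 𝒜, Commute A B) (hstar : ∀ A ∈ 𝒜, star A ∈ 𝒜) {W : Submodule ℂ H}
    (hWc : IsClosed (W : Set H)) (hW : ∀ A ∈ 𝒜, ∀ w ∈ W, A w ∈ W) {A : H →L[ℂ] H} (hA : A ∈ 𝒜)
    {w : H} (hw : w ∈ W) (hAw : A w ≠ 0) :
    ∃ v ∈ W, (∃ B ∈ 𝒜, B v ≠ 0) ∧ ∀ B ∈ 𝒜, ∃ c : ℂ, B v = c • v := by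
  have : CompleteSpace W := hWc.completeSpace_coe
  have hW' : ∀ u ∈ W, (star A * A) u ∈ W := fun u hu => hW _ (hstar A hA) _ (hW A hA u hu)
  have hsymm : (star A * A).IsSymmetric := (IsSelfAdjoint.star_mul_self A).isSymmetric
  have hne : (star A * A).restrict hW' ≠ 0 := fun h => hAw <| by
    have h₀ : star A (A w) = 0 := congrArg Subtype.val (DFunLike.congr_fun h (⟨w, hw⟩ : W))
    rw [← inner_self_eq_zero (𝕜 := ℂ), ← ContinuousLinearMap.adjoint_inner_right,
      ← ContinuousLinearMap.star_eq_adjoint, h₀, inner_zero_right]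
  have hcomm' : ∀ B ∈ 𝒜, Commute (star A * A) B := fun B hB =>
    (hcomm _ (hstar A hA) B hB).mul_left (hcomm A hA B hB)
  obtain ⟨v, hv, hvT⟩ := exists_jointEigenvector_of_isCompactOperator
    (A := (star A * A).restrict hW') (((hcpt A hA).clm_comp (star A)).restrict' hW')
    (hsymm.restrict_invariant hW') hne
    (fun B : 𝒜 => B.1.toLinearMap.restrict (hW B.1 B.2))
    (fun B => LinearMap.ext fun u => Subtype.ext (DFunLike.congr_fun (hcomm' B.1 B.2) u.1))
    (fun B C => LinearMap.ext fun u => Subtype.ext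
      (DFunLike.congr_fun (hcomm B.1 B.2 C.1 C.2) u.1))
  refine ⟨v, v.2, ⟨A, hA, fun h => hv (Subtype.ext ?_)⟩,
    fun B hB => (hvT ⟨B, hB⟩).imp fun c hc => congrArg Subtype.val hc⟩
  exact (congrArg (star A : H →L[ℂ] H) h).trans (map_zero _)

theorem exists_orthonormal_jointEigenvectors (hcpt : ∀ A ∈ 𝒜, IsCompactOperator A)
    (hcomm : ∀ A ∈ 𝒜, ∀ B ∈ 𝒜, Commute A B) (hstar : ∀ A ∈ 𝒜, star A ∈ 𝒜) {P : Set H}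
    (hsmul : ∀ (c : ℂ), ∀ x ∈ P, c • x ∈ P) (hP : ∀ x ∈ P, ∀ A ∈ 𝒜, ∃ c : ℂ, A x = c • x)
    (hP' : ∀ x, (∀ A ∈ 𝒜, ∃ c : ℂ, A x = c • x) → (∃ A ∈ 𝒜, A x ≠ 0) → x ∈ P) :
    ∃ V ⊆ P, Orthonormal ℂ ((↑) : V → H) ∧ (∀ x ∈ P, (∀ v ∈ V, inner ℂ v x = 0) → x = 0) ∧
      ∀ A ∈ 𝒜, ∀ w, (∀ v ∈ V, inner ℂ v w = 0) → A w = 0 := by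
  obtain ⟨V, hVP, hV, hmax⟩ := exists_orthonormal_subset_maximal hsmul
  refine ⟨V, hVP, hV, hmax, fun A hA w hw => ?_⟩
  by_contra hAw
  obtain ⟨v, hvW, hv₀, hv⟩ := exists_jointEigenvector_mem hcpt hcomm hstar
    (Submodule.isClosed_orthogonal (Submodule.span ℂ V))
    (fun B hB => apply_mem_orthogonal_of_star_eigenvectors
      fun v hv => hP v (hVP hv) _ (hstar B hB))
    hA (mem_orthogonal_span_iff.2 hw) hAw
  have hv_zero : v = 0 := hmax v (hP' v hv hv₀) (mem_orthogonal_span_iff.1 hvW)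
  obtain ⟨B, -, hB⟩ := hv₀
  exact hB (hv_zero ▸ map_zero B)

end Spectral

/-! ### Operators on `ℓ₂` induced by operators from `s'` to `s` -/

/-- The Hilbert space `ℓ₂`, which lies between `s` and `s'`. -/
abbrev L2 : Type := lp (fun _ : ℕ => ℂ) 2

theorem wseq_zero (ξ : ℕ → ℂ) : wseq 0 ξ = ξ := by
  funext j; simp [wseq]

theorem L2.wmem (g : L2) : WMem 0 g := by
  rw [wmem_iff, wseq_zero]; exact g.2

theorem L2.wnorm_zero (g : L2) : wnorm 0 g = ‖g‖ := by
  rw [wnorm_eq g.wmem]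
  congr 1
  exact Subtype.ext (wseq_zero g)

theorem pairing_eq_inner (g h : L2) : pairing g h = inner ℂ h g := by
  rw [lp.inner_eq_tsum]
  rfl

/-- The inclusion of `s` into `ℓ₂`. -/
def S.toL2 : S →ₗ[ℂ] L2 where
  toFun ξ := ⟨S.toSeq ξ, by simpa only [wseq_zero] using! (wmem_iff 0 ξ).1 (ξ.wmem 0)⟩
  map_add' _ _ := rfl
  map_smul' _ _ := rfl

theorem S.toL2_injective : Function.Injective S.toL2 := fun _ _ h =>
  S.ext fun j => congrFun (congrArg Subtype.val h) j

theorem S.norm_toL2 (ξ : S) : ‖S.toL2 ξ‖ = wnorm 0 ξ := (L2.wnorm_zero _).symm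

/-- The inclusion of `ℓ₂` into `s'`. -/
def L2.toDual : L2 →ₗ[ℂ] SDual where
  toFun g := SDual.mk g ⟨0, g.wmem⟩
  map_add' _ _ := rfl
  map_smul' _ _ := rfl

theorem L2.toSeq_toDual (g : L2) : SDual.toSeq (L2.toDual g) = g := rfl

theorem exists_wnorm_apply_toDual_le (x : SDual →L[ℂ] S) (q : ℕ) :
    ∃ C, 0 ≤ C ∧ ∀ g : L2, wnorm q (x (L2.toDual g)) ≤ C * ‖g‖ := by
  obtain ⟨C, hC0, hC⟩ := bound_of_clm x q 0
  refine ⟨C, hC0, fun g => ?_⟩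
  simpa only [Nat.cast_zero, neg_zero, L2.toSeq_toDual, L2.wnorm_zero] using
    hC (L2.toDual g) (by simpa using! g.wmem)

/-- The operator on `ℓ₂` induced by an operator from `s'` to `s`, as a `*`-homomorphism. -/
def hat : (SDual →L[ℂ] S) →⋆ₙₐ[ℂ] (L2 →L[ℂ] L2) where
  toFun x := (S.toL2 ∘ₗ x.toLinearMap ∘ₗ L2.toDual).mkContinuousOfExistsBound <| by
    obtain ⟨C, -, hC⟩ := exists_wnorm_apply_toDual_le x 0
    exact ⟨C, fun g => (S.norm_toL2 _).trans_le (hC g)⟩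
  map_smul' _ _ := rfl
  map_zero' := rfl
  map_add' _ _ := rfl
  map_mul' _ _ := rfl
  map_star' x := by
    rw [ContinuousLinearMap.star_eq_adjoint, ContinuousLinearMap.eq_adjoint_iff]
    exact fun g h => (pairing_eq_inner h (S.toL2 (star x (L2.toDual g)))).symm.trans <|
      (pairing_star x (L2.toDual h) (L2.toDual g)).symm.trans <|
        pairing_eq_inner (S.toL2 (x (L2.toDual h))) g

theorem hat_apply (x : SDual →L[ℂ] S) (g : L2) : hat x g = S.toL2 (x (L2.toDual g)) := rfl

theorem hat_toL2 (x : SDual →L[ℂ] S) (ξ : S) : hat x (S.toL2 ξ) = S.toL2 (x (incl ξ)) := rfl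

theorem clm_ext_unit {x y : SDual →L[ℂ] S} (h : ∀ j, x (SDual.unit j) = y (SDual.unit j)) :
    x = y := by
  refine star_injective (ContinuousLinearMap.ext fun η => S.ext fun j => ?_)
  rw [star_apply, star_apply, h]

theorem hat_injective : Function.Injective hat := fun _ _ h =>
  clm_ext_unit fun j => S.toL2_injective (DFunLike.congr_fun h (S.toL2 (S.unit j)))

theorem eq_zero_of_eq_zero_on_orthogonal {𝕜 H F : Type*} [RCLike 𝕜] [NormedAddCommGroup H]
    [InnerProductSpace 𝕜 H] [CompleteSpace H] [NormedAddCommGroup F] [NormedSpace 𝕜 F]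
    {T : H →L[𝕜] F} {V : Set H} (hV : ∀ v ∈ V, T v = 0)
    (hV' : ∀ w, (∀ v ∈ V, inner 𝕜 v w = 0) → T w = 0) : T = 0 := by
  have : CompleteSpace T.ker := T.isClosed_ker.completeSpace_coe
  have hker : T.ker = ⊤ := by
    rw [← Submodule.orthogonal_eq_bot_iff, eq_bot_iff]
    intro w hw
    have hwT : w ∈ T.ker := hV' w fun v hv => hw v (hV v hv)
    exact inner_self_eq_zero.1 (hw w hwT)
  exact ContinuousLinearMap.ext fun w => (hker ▸ Submodule.mem_top : w ∈ T.ker)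

theorem clm_ext_orthogonal {ι : Type*} (f : ι → S) {x y : SDual →L[ℂ] S}
    (h : ∀ i, x (incl (f i)) = y (incl (f i)))
    (h' : ∀ g : L2, (∀ i, pairing g (f i) = 0) → x (L2.toDual g) = y (L2.toDual g)) : x = y := by
  refine hat_injective <| sub_eq_zero.1 <|
    eq_zero_of_eq_zero_on_orthogonal (V := Set.range (S.toL2 ∘ f)) ?_ fun g hg => ?_
  · rintro _ ⟨i, rfl⟩
    exact sub_eq_zero.2 (congrArg S.toL2 (h i))
  · exact sub_eq_zero.2 <| congrArg S.toL2 <| h' g fun i =>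
      (pairing_eq_inner g (S.toL2 (f i))).trans (hg _ (Set.mem_range_self i))

/-- The truncation of a sequence in `ℓ₂` to its first `n` coordinates; these operators of finite
rank approximate the operators with values in a weighted space, and so show their compactness. -/
def truncate (n : ℕ) : L2 →L[ℂ] L2 :=
  ∑ i ∈ Finset.range n, (lp.singleContinuousLinearMap ℂ (fun _ : ℕ => ℂ) 2 i) ∘L
    (lp.evalCLM ℂ (fun _ : ℕ => ℂ) 2 i)

theorem truncate_apply (n : ℕ) (g : L2) (j : ℕ) : truncate n g j = if j < n then g j else 0 := by
  have h : truncate n g = ∑ i ∈ Finset.range n, lp.single 2 i (g i) := by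
    simp [truncate, lp.evalCLM]
  rw [h, lp.coeFn_sum, Finset.sum_apply]
  simp [Pi.single_apply]

theorem isCompactOperator_truncate (n : ℕ) : IsCompactOperator (truncate n) := by
  have : truncate n ∈ compactOperator (RingHom.id ℂ) L2 L2 :=
    Submodule.sum_mem _ fun i _ =>
      (isCompactOperator_of_locallyCompactSpace_dom
        (lp.evalCLM ℂ (fun _ : ℕ => ℂ) 2 i)).clm_comp
        (lp.singleContinuousLinearMap ℂ (fun _ : ℕ => ℂ) 2 i)
  exact this

theorem norm_sub_truncate_le (n : ℕ) {g : L2} (hg : WMem 1 g) :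
    ‖g - truncate n g‖ ≤ wnorm 1 g / (n + 1) := by
  have hn : (0 : ℝ) < (n : ℝ) + 1 := by positivity
  rw [← L2.wnorm_zero, le_div_iff₀ hn, ← Real.sqrt_sq hn.le, wnorm, wnorm,
    ← Real.sqrt_mul (by positivity), ← tsum_mul_right]
  refine Real.sqrt_le_sqrt (Summable.tsum_le_tsum (fun j => ?_) ((L2.wmem _).mul_right _) hg)
  rw [lp.coeFn_sub, Pi.sub_apply, truncate_apply]
  split_ifs with hj
  · have := zpow_pos (weight_pos j) (2 * 1)
    rw [sub_self, norm_zero, zero_pow two_ne_zero, zero_mul, zero_mul]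
    positivity
  · rw [sub_zero, mul_zero, zpow_zero, mul_one]
    norm_cast
    gcongr
    exact not_lt.1 hj

theorem isCompactOperator_of_wnorm_one_le {X : Type*} [NormedAddCommGroup X] [NormedSpace ℂ X]
    {T : X →L[ℂ] L2} {C : ℝ} (hC : 0 ≤ C) (hT : ∀ g, WMem 1 (T g))
    (hTC : ∀ g, wnorm 1 (T g) ≤ C * ‖g‖) : IsCompactOperator T := by
  refine isCompactOperator_of_tendsto (l := Filter.atTop) (F := fun n : ℕ => truncate n ∘L T) ?_
    (Filter.Eventually.of_forall fun n => (isCompactOperator_truncate n).comp_clm T)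
  have hnorm : ∀ n : ℕ, ‖truncate n ∘L T - T‖ ≤ C / (n + 1 : ℕ) := fun n => by
    refine ContinuousLinearMap.opNorm_le_bound _ (by positivity) fun g => ?_
    calc ‖truncate n (T g) - T g‖ = ‖T g - truncate n (T g)‖ := norm_sub_rev _ _
      _ ≤ wnorm 1 (T g) / (n + 1) := norm_sub_truncate_le n (hT g)
      _ ≤ C * ‖g‖ / (n + 1) := by gcongr; exact hTC g
      _ = C / (n + 1 : ℕ) * ‖g‖ := by push_cast; ring
  rw [tendsto_iff_norm_sub_tendsto_zero]
  exact squeeze_zero (fun _ => norm_nonneg _) hnorm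
    ((tendsto_const_div_atTop_nhds_zero_nat C).comp (Filter.tendsto_add_atTop_nat 1))

theorem isCompactOperator_hat (x : SDual →L[ℂ] S) : IsCompactOperator (hat x) := by
  obtain ⟨C, hC0, hC⟩ := exists_wnorm_apply_toDual_le x 1
  exact isCompactOperator_of_wnorm_one_le hC0 (fun g => (x (L2.toDual g)).wmem 1) hC

/-! ### Functionals and series on `s` -/

theorem S.eq_zero_of_wnorm_eq_zero {ξ : S} (h : wnorm 0 ξ = 0) : ξ = 0 := by
  rw [← S.norm_toL2, norm_eq_zero] at h
  exact S.toL2_injective (h.trans (map_zero _).symm)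

theorem S.wnorm_pos {ξ : S} (h : ξ ≠ 0) (q : ℕ) : 0 < wnorm q ξ :=
  ((wnorm_nonneg 0 ξ).lt_of_ne' (mt S.eq_zero_of_wnorm_eq_zero h)).trans_le
    (wnorm_mono q.cast_nonneg (ξ.wmem q))

theorem S.wnorm_smul (p : ℤ) (c : ℂ) (ξ : S) :
    wnorm p (S.toSeq (c • ξ)) = ‖c‖ * wnorm p ξ := by
  rw [map_smul, _root_.SmoothOp.wnorm_smul]

instance : T2Space S := by
  have : T1Space S := S.withSeminorms.T1_of_separating fun ξ hξ =>
    ⟨0, fun h => hξ (S.eq_zero_of_wnorm_eq_zero h)⟩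
  infer_instance

theorem norm_pairing_apply_le {q : ℕ} {η : ℕ → ℂ} (hη : WMem (-q) η) (ξ : S) :
    ‖pairing η ξ‖ ≤ wnorm (-q) η * wnorm q ξ := by
  simpa only [neg_neg] using norm_pairing_le hη (ξ.wmem (- -q))

/-- The linear functional `⟨·, η⟩` on `s`, for `η ∈ s'`. -/
def S.pairingLin (η : SDual) : S →ₗ[ℂ] ℂ where
  toFun ξ := pairing ξ η
  map_add' ξ ξ' := by
    obtain ⟨r, hr⟩ := η.exists_wmem
    rw [pairing, pairing, pairing, ← Summable.tsum_add
      (pairing_summable (ξ.wmem r) hr) (pairing_summable (ξ'.wmem r) hr)]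
    exact tsum_congr fun j => by rw [map_add, Pi.add_apply, add_mul]
  map_smul' c ξ := by
    rw [pairing, pairing, RingHom.id_apply, smul_eq_mul, ← tsum_mul_left]
    exact tsum_congr fun j => by rw [map_smul, Pi.smul_apply, smul_eq_mul, mul_assoc]

/-- The functional `⟨·, η⟩` on `s`, for `η ∈ s'`, as a continuous one. -/
def S.pairingCLM (η : SDual) : S →L[ℂ] ℂ where
  toLinearMap := S.pairingLin η
  cont := by
    obtain ⟨r, hr⟩ := η.exists_wmem
    refine WithSeminorms.continuous_of_isBounded S.withSeminorms (norm_withSeminorms ℂ ℂ) _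
      fun _ => ⟨{r}, (wnorm (-r) η).toNNReal, fun ξ => ?_⟩
    rw [Finset.sup_singleton, smul_apply, NNReal.smul_def, smul_eq_mul,
      Real.coe_toNNReal _ (wnorm_nonneg _ _)]
    exact (norm_pairing_le (ξ.wmem r) hr).trans_eq (mul_comm _ _)

theorem S.pairingCLM_apply (η : SDual) (ξ : S) : S.pairingCLM η ξ = pairing ξ η := rfl

theorem pairing_smul_right (η : SDual) (c : ℂ) (ξ : S) :
    pairing η (S.toSeq (c • ξ)) = conj c * pairing η ξ := by
  rw [← pairing_conj, ← pairing_conj ξ, ← map_mul, ← S.pairingCLM_apply, map_smul, smul_eq_mul,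
    S.pairingCLM_apply]

/-- The sequence `ξ ∈ s` multiplied by the weight `(j + 1) ^ p`, as an element of `ℓ₂`. -/
def S.weighted (p : ℤ) : S →ₗ[ℂ] L2 where
  toFun ξ := ⟨wseq p ξ, (wmem_iff p ξ).1 (ξ.wmem p)⟩
  map_add' ξ η := Subtype.ext (wseq_add p ξ η)
  map_smul' c ξ := Subtype.ext (wseq_smul p c ξ)

theorem S.norm_weighted (p : ℤ) (ξ : S) : ‖S.weighted p ξ‖ = wnorm p ξ :=
  (wnorm_eq (ξ.wmem p)).symm

theorem S.wseq_tsum_toL2 {ι : Type*} {u : ι → S} {p : ℤ} (h₀ : Summable fun j => S.toL2 (u j))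
    (hp : Summable fun j => S.weighted p (u j)) :
    wseq p (∑' j, S.toL2 (u j) : L2) = (∑' j, S.weighted p (u j) : L2) :=
  funext fun i =>
    ((h₀.hasSum.mapL (lp.evalCLM ℂ (fun _ : ℕ => ℂ) 2 i)).mul_right _).unique
      (hp.hasSum.mapL (lp.evalCLM ℂ (fun _ : ℕ => ℂ) 2 i))

theorem S.summable_of_summable_wnorm {ι : Type*} {u : ι → S}
    (h : ∀ q : ℕ, Summable fun j => wnorm q (u j)) : Summable u := by
  have hs : ∀ q : ℕ, Summable fun j => S.weighted q (u j) := fun q =>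
    .of_norm (by simpa only [S.norm_weighted] using h q)
  have h₀ : Summable fun j => S.toL2 (u j) :=
    .of_norm (by simpa only [S.norm_toL2, Nat.cast_zero] using h 0)
  have hw := fun q => S.wseq_tsum_toL2 h₀ (hs q)
  let g : S := S.mk (∑' j, S.toL2 (u j) : L2) fun q => by
    rw [wmem_iff, hw]
    exact (∑' j, S.weighted q (u j) : L2).2
  have hg : ∀ q : ℕ, S.weighted q g = ∑' j, S.weighted q (u j) := fun q => Subtype.ext (hw q)
  refine ⟨g, (S.withSeminorms.tendsto_nhds _ g).2 fun q ε hε => ?_⟩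
  filter_upwards [(tendsto_iff_norm_sub_tendsto_zero.1 (hs q).hasSum).eventually
    (gt_mem_nhds hε)] with F hF
  rwa [sNorm_apply, ← S.norm_weighted, map_sub, map_sum, hg]

theorem S.wnorm_tsum_le {ι : Type*} {u : ι → S}
    (h : ∀ q : ℕ, Summable fun j => wnorm q (u j)) (q : ℕ) :
    wnorm q (S.toSeq (∑' j, u j)) ≤ ∑' j, wnorm q (u j) := by
  refine le_of_tendsto (((S.withSeminorms.continuous_seminorm q).tendsto _).comp
    (S.summable_of_summable_wnorm h).hasSum) (Filter.Eventually.of_forall fun F => ?_)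
  exact (Finset.le_sum_of_subadditive (sNorm q) (map_zero _).le (map_add_le_add _) F u).trans
    ((h q).sum_le_tsum F fun _ _ => wnorm_nonneg _ _)

/-! ### Norm estimates for orthonormal sequences in `s` -/

theorem pairing_wseq_self (p : ℤ) (ξ : ℕ → ℂ) :
    pairing (wseq (2 * p) ξ) ξ = ((wnorm p ξ ^ 2 : ℝ) : ℂ) := by
  rw [wnorm, Real.sq_sqrt (tsum_nonneg fun j => ?_), Complex.ofReal_tsum]
  · refine tsum_congr fun j => ?_
    rw [wseq, mul_right_comm, Complex.mul_conj, Complex.normSq_eq_norm_sq, Complex.ofReal_mul]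
  · have := zpow_pos (weight_pos j) (2 * p)
    positivity

theorem wnorm_sq_le (p : ℤ) (ξ : S) : wnorm p ξ ^ 2 ≤ wnorm 0 ξ * wnorm (2 * p) ξ := by
  have h := norm_inner_le_norm (𝕜 := ℂ) (S.toL2 ξ) (S.weighted (2 * p) ξ)
  rw [S.norm_toL2, S.norm_weighted, ← pairing_eq_inner] at h
  change ‖pairing (wseq (2 * p) ξ) ξ‖ ≤ _ at h
  rwa [pairing_wseq_self, Complex.norm_real, Real.norm_of_nonneg (by positivity)] at h

theorem orthonormalSeq_iff {f : ℕ → S} :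
    OrthonormalSeq f ↔ Orthonormal ℂ fun j => S.toL2 (f j) := by
  simp only [orthonormal_iff_ite, ← pairing_eq_inner]
  rw [OrthonormalSeq, forall_comm]
  exact forall₂_congr fun i j => by simp only [@eq_comm _ i j]; rfl

namespace OrthonormalSeq

variable {f : ℕ → S} (hf : OrthonormalSeq f)
include hf

theorem pow_four_le (j q : ℕ) : wnorm q (f j) ^ 4 ≤ wnorm (4 * q : ℕ) (f j) := by
  have h₁ := wnorm_sq_le q (f j)
  have h₂ := wnorm_sq_le (2 * q) (f j)
  rw [hf.wnorm_zero, one_mul] at h₁ h₂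
  calc wnorm q (f j) ^ 4 = (wnorm q (f j) ^ 2) ^ 2 := by ring
    _ ≤ wnorm (2 * q) (f j) ^ 2 := by gcongr
    _ ≤ wnorm (2 * (2 * q)) (f j) := h₂
    _ = wnorm (4 * q : ℕ) (f j) := by congr 1; push_cast; ring

theorem wnorm_mul_wnorm_mul_le (j q r : ℕ) :
    wnorm q (f j) * wnorm r (f j) * wnorm 1 (f j) ^ 2 ≤ wnorm (4 * (q + r + 1) : ℕ) (f j) := by
  have hmono : ∀ k ≤ q + r + 1, wnorm k (f j) ≤ wnorm (q + r + 1 : ℕ) (f j) := fun k hk =>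
    wnorm_mono (Int.ofNat_le.2 hk) ((f j).wmem _)
  have hq := hmono q (by lia)
  have hr := hmono r (by lia)
  have h₁ : wnorm 1 (f j) ≤ _ := hmono 1 (by lia)
  have hr₀ := wnorm_nonneg r (f j)
  have h₁₀ := wnorm_nonneg 1 (f j)
  have hM₀ := wnorm_nonneg (q + r + 1 : ℕ) (f j)
  calc wnorm q (f j) * wnorm r (f j) * wnorm 1 (f j) ^ 2
      ≤ wnorm (q + r + 1 : ℕ) (f j) * wnorm (q + r + 1 : ℕ) (f j) *
        wnorm (q + r + 1 : ℕ) (f j) ^ 2 := by gcongr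
    _ = wnorm (q + r + 1 : ℕ) (f j) ^ 4 := by ring
    _ ≤ wnorm (4 * (q + r + 1) : ℕ) (f j) := hf.pow_four_le j _

theorem sum_norm_sq_le (F : Finset ℕ) (i : ℕ) : ∑ j ∈ F, ‖f j i‖ ^ 2 ≤ 1 := by
  have hunit : ‖S.toL2 (S.unit i)‖ = 1 :=
    (S.norm_toL2 _).trans ((wnorm_single 0 i).trans (zpow_zero _))
  have hcoord : ∀ j, ‖f j i‖ = ‖inner ℂ (S.toL2 (f j)) (S.toL2 (S.unit i))‖ := fun j => by
    rw [norm_inner_symm, ← pairing_eq_inner]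
    exact congrArg norm (pairing_single_right _ _).symm
  simpa only [hcoord, hunit, one_pow] using
    (orthonormalSeq_iff.1 hf).sum_inner_products_le (x := S.toL2 (S.unit i)) (s := F)

theorem summable_wnorm_neg_one_sq : Summable fun j => wnorm (-1) (f j) ^ 2 := by
  have hS : Summable fun i : ℕ => ((i : ℝ) + 1) ^ (2 * (-1 : ℤ)) := by
    refine summable_inv_weight.congr fun i => ?_
    rw [mul_neg, mul_one, zpow_neg, one_div]
    norm_cast
  have hsq : ∀ j, wnorm (-1) (f j) ^ 2 = ∑' i : ℕ, ‖f j i‖ ^ 2 * ((i : ℝ) + 1) ^ (2 * (-1 : ℤ)) :=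
    fun j => Real.sq_sqrt <| tsum_nonneg fun i =>
      mul_nonneg (sq_nonneg _) (zpow_pos (weight_pos i) _).le
  refine summable_of_sum_le (c := ∑' i : ℕ, ((i : ℝ) + 1) ^ (2 * (-1 : ℤ)))
    (fun j => sq_nonneg _) fun F => ?_
  calc ∑ j ∈ F, wnorm (-1) (f j) ^ 2
      = ∑' i : ℕ, ∑ j ∈ F, ‖f j i‖ ^ 2 * ((i : ℝ) + 1) ^ (2 * (-1 : ℤ)) := by
        simp only [hsq]
        rw [Summable.tsum_finsetSum fun j _ => (f j).wmem (-1)]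
    _ ≤ ∑' i : ℕ, ((i : ℝ) + 1) ^ (2 * (-1 : ℤ)) := by
        refine Summable.tsum_le_tsum (fun i => ?_) (summable_sum fun j _ => (f j).wmem (-1)) hS
        rw [← Finset.sum_mul]
        exact mul_le_of_le_one_left (zpow_pos (weight_pos i) _).le (hf.sum_norm_sq_le F i)

theorem one_le_wnorm_one_mul (j : ℕ) : 1 ≤ wnorm 1 (f j) * wnorm (-1) (f j) := by
  have h := norm_pairing_le ((f j).wmem 1) ((f j).wmem (-1))
  rwa [hf j j, if_pos rfl, norm_one] at h

theorem summable_inv_wnorm_one_sq : Summable fun j => (wnorm 1 (f j) ^ 2)⁻¹ := by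
  refine hf.summable_wnorm_neg_one_sq.of_nonneg_of_le (fun j => by positivity) fun j => ?_
  have hpos : 0 < wnorm 1 (f j) := zero_lt_one.trans_le (hf.one_le j 1)
  rw [← inv_pow]
  gcongr
  exact (inv_le_iff_one_le_mul₀' hpos).2 (hf.one_le_wnorm_one_mul j)

end OrthonormalSeq

/-! ### Bounded subsets of `s'` -/

theorem bddAbove_norm_pairing {g : ℕ → S} (hg : ∀ q : ℕ, ∃ D, ∀ n, wnorm q (g n) ≤ D)
    (η : SDual) : BddAbove (Set.range fun n => ‖pairing η (g n)‖) := by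
  obtain ⟨q, hq⟩ := η.exists_wmem
  obtain ⟨D, hD⟩ := hg q
  refine ⟨wnorm (-q) η * D, ?_⟩
  rintro _ ⟨n, rfl⟩
  exact (norm_pairing_apply_le hq (g n)).trans
    (mul_le_mul_of_nonneg_left (hD n) (wnorm_nonneg _ _))

/-- The seminorm `η ↦ supₙ |⟨η, gₙ⟩|` on `s'`, for a bounded sequence `(gₙ)` in `s`. -/
def supPairing (g : ℕ → S) (hg : ∀ q : ℕ, ∃ D, ∀ n, wnorm q (g n) ≤ D) : Seminorm ℂ SDual :=
  Seminorm.of (fun η => ⨆ n, ‖pairing η (g n)‖)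
    (fun η ζ => ciSup_le fun n => by
      rw [pairing_add_left]
      exact (norm_add_le _ _).trans (add_le_add (le_ciSup (bddAbove_norm_pairing hg η) n)
        (le_ciSup (bddAbove_norm_pairing hg ζ) n)))
    (fun c η => by
      rw [Real.mul_iSup_of_nonneg (norm_nonneg c)]
      exact iSup_congr fun n => by rw [pairing_smul_left, norm_mul])

theorem stepBounded_supPairing {g : ℕ → S} (hg : ∀ q : ℕ, ∃ D, ∀ n, wnorm q (g n) ≤ D) :
    StepBounded (supPairing g hg) := fun q => by
  obtain ⟨D, hD⟩ := hg q
  refine ⟨D, fun η hη => ciSup_le fun n => ?_⟩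
  rw [mul_comm]
  exact (norm_pairing_apply_le hη (g n)).trans
    (mul_le_mul_of_nonneg_left (hD n) (wnorm_nonneg _ _))

theorem exists_norm_pairing_le {B : Set SDual} (hB : Bornology.IsVonNBounded ℂ B) {g : ℕ → S}
    (hg : ∀ q : ℕ, ∃ D, ∀ n, wnorm q (g n) ≤ D) :
    ∃ R, ∀ η ∈ B, ∀ n, ‖pairing η (g n)‖ ≤ R := by
  obtain ⟨R, -, hR⟩ := SDual.withSeminorms.isVonNBounded_iff_seminorm_bounded.1 hB
    ⟨supPairing g hg, stepBounded_supPairing hg⟩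
  exact ⟨R, fun η hη n => (le_ciSup (bddAbove_norm_pairing hg η) n).trans (hR η hη).le⟩

theorem exists_wnorm_le_of_wnorm_self_le_one {g : ℕ → S} (hg : ∀ n : ℕ, wnorm n (g n) ≤ 1)
    (q : ℕ) : ∃ D, ∀ n, wnorm q (g n) ≤ D := by
  obtain ⟨D, hD⟩ := ((Set.finite_Iio q).image fun n => wnorm q (g n)).bddAbove
  refine ⟨max D 1, fun n => ?_⟩
  rcases lt_or_ge n q with hn | hn
  · exact le_max_of_le_left (hD ⟨n, hn, rfl⟩)
  · exact le_max_of_le_right <|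
      (wnorm_mono (Int.ofNat_le.2 hn) ((g n).wmem n)).trans (hg n)

theorem exists_forall_norm_pairing_le {B : Set SDual} (hB : Bornology.IsVonNBounded ℂ B) :
    ∃ (r : ℕ) (C : ℝ), 0 ≤ C ∧ ∀ η ∈ B, ∀ ξ : S, ‖pairing η ξ‖ ≤ C * wnorm r ξ := by
  by_contra! h
  choose η hη g hg using fun n : ℕ => h n n n.cast_nonneg
  have hpos : ∀ n : ℕ, 0 < wnorm n (g n) := fun n => S.wnorm_pos (fun h0 => by
    have := hg n
    simp [h0, pairing, wnorm] at this) n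
  let c : ℕ → ℂ := fun n => ((wnorm n (g n))⁻¹ : ℝ)
  have hc : ∀ n, ‖c n‖ = (wnorm n (g n))⁻¹ := fun n => by
    rw [Complex.norm_real, Real.norm_of_nonneg (inv_nonneg.2 (hpos n).le)]
  obtain ⟨R, hR⟩ := exists_norm_pairing_le hB (g := fun n => c n • g n) <|
    exists_wnorm_le_of_wnorm_self_le_one fun n => by
      rw [S.wnorm_smul, hc, inv_mul_cancel₀ (hpos n).ne']
  obtain ⟨n, hn⟩ := exists_nat_gt R
  have hle : ‖pairing (η n) (g n)‖ ≤ wnorm n (g n) * R := by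
    have := hR (η n) (hη n) n
    rwa [pairing_smul_right, norm_mul, RCLike.norm_conj, hc, inv_mul_le_iff₀ (hpos n)] at this
  have := mul_lt_mul_of_pos_right hn (hpos n)
  linarith [hg n]

/-! ### The diagonal operators of an orthonormal sequence -/

namespace OrthonormalSeq

theorem wnorm_incl {f : ℕ → S} (hf : OrthonormalSeq f) (j : ℕ) :
    wnorm (-(0 : ℕ)) (incl (f j)) = 1 := by
  rw [Nat.cast_zero, neg_zero]
  exact hf.wnorm_zero j

theorem pairing_smul_self {f : ℕ → S} (hf : OrthonormalSeq f) (c : ℂ) (j : ℕ) :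
    S.pairingCLM (incl (f j)) (c • f j) = c := by
  rw [map_smul, smul_eq_mul]
  exact (congrArg (c * ·) ((hf j j).trans (if_pos rfl))).trans (mul_one c)

theorem exists_eq_smul_iff {f : ℕ → S} (hf : OrthonormalSeq f) {ξ : S} {j : ℕ} :
    (∃ c : ℂ, ξ = c • f j) ↔ ξ = S.pairingCLM (incl (f j)) ξ • f j := by
  refine ⟨?_, fun h => ⟨_, h⟩⟩
  rintro ⟨c, rfl⟩
  rw [hf.pairing_smul_self]

theorem isVonNBounded_range {f : ℕ → S} (hf : OrthonormalSeq f) :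
    Bornology.IsVonNBounded ℂ (Set.range fun j => incl (f j)) := by
  refine SDual.withSeminorms.isVonNBounded_iff_seminorm_bddAbove.2 fun p => ?_
  obtain ⟨C, hC⟩ := p.2 0
  refine ⟨C, ?_⟩
  rintro _ ⟨_, ⟨j, rfl⟩, rfl⟩
  simpa only [hf.wnorm_incl, mul_one] using! hC (incl (f j)) ((f j).wmem _)

end OrthonormalSeq

section Diagonal

variable {f : ℕ → S} {hf : OrthonormalSeq f}

theorem norm_coord_mul_le (ξ : KotheSpace (normMatrix f hf)) (q r j : ℕ) :
    ‖ξ j‖ * (wnorm q (f j) * wnorm r (f j)) ≤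
      KotheSpace.seminorms _ (4 * (q + r + 1)) ξ * (wnorm 1 (f j) ^ 2)⁻¹ := by
  have hpos : 0 < wnorm 1 (f j) := zero_lt_one.trans_le (hf.one_le j 1)
  rw [← div_eq_mul_inv, le_div_iff₀ (by positivity), mul_assoc]
  exact (mul_le_mul_of_nonneg_left (hf.wnorm_mul_wnorm_mul_le j q r) (norm_nonneg _)).trans
    (KotheSpace.le_iSup ξ _ j)

theorem wnorm_diagTerm_le (ξ : KotheSpace (normMatrix f hf)) {η : SDual} {r : ℕ} {C : ℝ}
    (hC : 0 ≤ C) (hη : ∀ j, ‖pairing η (f j)‖ ≤ C * wnorm r (f j)) (q j : ℕ) :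
    wnorm q (S.toSeq ((ξ j * pairing η (f j)) • f j)) ≤
      C * KotheSpace.seminorms _ (4 * (q + r + 1)) ξ * (wnorm 1 (f j) ^ 2)⁻¹ := by
  have := wnorm_nonneg q (f j)
  calc wnorm q (S.toSeq ((ξ j * pairing η (f j)) • f j))
      = ‖ξ j‖ * ‖pairing η (f j)‖ * wnorm q (f j) := by rw [S.wnorm_smul, norm_mul]
    _ ≤ ‖ξ j‖ * (C * wnorm r (f j)) * wnorm q (f j) := by gcongr; exact hη j
    _ = C * (‖ξ j‖ * (wnorm q (f j) * wnorm r (f j))) := by ring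
    _ ≤ C * (KotheSpace.seminorms _ (4 * (q + r + 1)) ξ * (wnorm 1 (f j) ^ 2)⁻¹) :=
        mul_le_mul_of_nonneg_left (norm_coord_mul_le ξ q r j) hC
    _ = _ := (mul_assoc _ _ _).symm

theorem summable_wnorm_diagTerm (ξ : KotheSpace (normMatrix f hf)) (η : SDual) (q : ℕ) :
    Summable fun j => wnorm q (S.toSeq ((ξ j * pairing η (f j)) • f j)) := by
  obtain ⟨r, hr⟩ := η.exists_wmem
  exact Summable.of_nonneg_of_le (fun j => wnorm_nonneg _ _)
    (wnorm_diagTerm_le ξ (wnorm_nonneg _ _) (fun j => norm_pairing_apply_le hr (f j)) q)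
    (hf.summable_inv_wnorm_one_sq.mul_left _)

theorem summable_diagTerm (ξ : KotheSpace (normMatrix f hf)) (η : SDual) :
    Summable fun j => (ξ j * pairing η (f j)) • f j :=
  S.summable_of_summable_wnorm (summable_wnorm_diagTerm ξ η)

variable (hf) in
/-- The linear map `η ↦ ∑ⱼ ξⱼ ⟨η, fⱼ⟩ fⱼ`. -/
def diagLin (ξ : KotheSpace (normMatrix f hf)) : SDual →ₗ[ℂ] S where
  toFun η := ∑' j, (ξ j * pairing η (f j)) • f j
  map_add' η ζ := by
    rw [← (summable_diagTerm ξ η).tsum_add (summable_diagTerm ξ ζ)]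
    exact tsum_congr fun j => by rw [pairing_add_left, mul_add, add_smul]
  map_smul' c η := by
    rw [RingHom.id_apply, ← (summable_diagTerm ξ η).tsum_const_smul c]
    exact tsum_congr fun j => by rw [pairing_smul_left, smul_smul, mul_left_comm]

theorem wnorm_diagLin_le (ξ : KotheSpace (normMatrix f hf)) {η : SDual} {r : ℕ} {C : ℝ}
    (hC : 0 ≤ C) (hη : ∀ j, ‖pairing η (f j)‖ ≤ C * wnorm r (f j)) (q : ℕ) :
    wnorm q (diagLin hf ξ η) ≤ C * KotheSpace.seminorms _ (4 * (q + r + 1)) ξ *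
      ∑' j, (wnorm 1 (f j) ^ 2)⁻¹ := by
  rw [← tsum_mul_left]
  exact (S.wnorm_tsum_le (summable_wnorm_diagTerm ξ η) q).trans
    ((summable_wnorm_diagTerm ξ η q).tsum_le_tsum (wnorm_diagTerm_le ξ hC hη q)
      (hf.summable_inv_wnorm_one_sq.mul_left _))

variable (hf) in
/-- The operator `∑ⱼ ξⱼ ⟨·, fⱼ⟩ fⱼ`, which depends linearly on `ξ ∈ λ^∞(|f_k|_q)`. -/
def diag : KotheSpace (normMatrix f hf) →ₗ[ℂ] (SDual →L[ℂ] S) where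
  toFun ξ := mkCLM (diagLin hf ξ) fun q r =>
    ⟨KotheSpace.seminorms _ (4 * (q + r + 1)) ξ * ∑' j, (wnorm 1 (f j) ^ 2)⁻¹, fun η hη =>
      (wnorm_diagLin_le ξ (wnorm_nonneg _ η) (fun j => norm_pairing_apply_le hη (f j)) q).trans_eq
        (by ring)⟩
  map_add' ξ ζ := ContinuousLinearMap.ext fun η => by
    refine Eq.trans ?_ ((summable_diagTerm ξ η).tsum_add (summable_diagTerm ζ η))
    exact tsum_congr fun j => by rw [map_add, Pi.add_apply, add_mul, add_smul]
  map_smul' c ξ := ContinuousLinearMap.ext fun η => by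
    refine Eq.trans ?_ ((summable_diagTerm ξ η).tsum_const_smul c)
    exact tsum_congr fun j => by rw [map_smul, Pi.smul_apply, smul_eq_mul, smul_smul, mul_assoc]

theorem diag_apply (ξ : KotheSpace (normMatrix f hf)) (η : SDual) :
    diag hf ξ η = ∑' j, (ξ j * pairing η (f j)) • f j := rfl

theorem diag_apply_self (ξ : KotheSpace (normMatrix f hf)) (k : ℕ) :
    diag hf ξ (incl (f k)) = ξ k • f k := by
  have hpair : ∀ j, pairing (incl (f k)) (f j) = if k = j then 1 else 0 := fun j => hf k j
  rw [diag_apply, tsum_eq_single k fun j hj => by rw [hpair, if_neg hj.symm, mul_zero, zero_smul],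
    hpair, if_pos rfl, mul_one]

theorem diag_apply_of_orthogonal (ξ : KotheSpace (normMatrix f hf)) {η : SDual}
    (hη : ∀ j, pairing η (f j) = 0) : diag hf ξ η = 0 := by
  simp only [diag_apply, hη, mul_zero, zero_smul, tsum_zero]

theorem diag_unit (k : ℕ) : diag hf (KotheSpace.unit _ k) = rankOne (f k) := by
  ext1 η
  have hunit : ∀ j, KotheSpace.unit (normMatrix f hf) k j = if j = k then 1 else 0 := fun j =>
    Pi.single_apply ..
  rw [diag_apply, tsum_eq_single k fun j hj => by rw [hunit, if_neg hj, zero_mul, zero_smul],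
    hunit, if_pos rfl, one_mul]
  rfl

theorem diag_injective : Function.Injective (diag hf) := fun ξ ζ h => KotheSpace.ext fun j => by
  have hj := DFunLike.congr_fun h (incl (f j))
  rw [diag_apply_self, diag_apply_self] at hj
  rw [← hf.pairing_smul_self (ξ j) j, hj, hf.pairing_smul_self]

theorem diag_mul (ξ ζ : KotheSpace (normMatrix f hf)) :
    diag hf (ξ * ζ) = diag hf ξ * diag hf ζ := by
  refine clm_ext_orthogonal f (fun j => ?_) fun g (hg : ∀ j, pairing (L2.toDual g) (f j) = 0) => ?_
  · rw [mul_apply, diag_apply_self, diag_apply_self, map_smul, map_smul, diag_apply_self,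
      KotheSpace.mul_apply, smul_smul, mul_comm]
  · rw [mul_apply, diag_apply_of_orthogonal _ hg, diag_apply_of_orthogonal _ hg, map_zero,
      map_zero]

theorem pairing_diag (ξ : KotheSpace (normMatrix f hf)) (η ζ : SDual) :
    pairing (diag hf ξ η) ζ = ∑' j, ξ j * pairing η (f j) * pairing (f j) ζ := by
  rw [← S.pairingCLM_apply, diag_apply, (S.pairingCLM ζ).map_tsum (summable_diagTerm ξ η)]
  exact tsum_congr fun j => by rw [map_smul, smul_eq_mul, S.pairingCLM_apply]

theorem diag_star (ξ : KotheSpace (normMatrix f hf)) :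
    diag hf (star ξ) = star (diag hf ξ) := by
  refine eq_star_of_pairing fun i η => ?_
  rw [← pairing_conj _ (SDual.toSeq (SDual.unit i)), pairing_diag, pairing_diag, Complex.conj_tsum]
  refine tsum_congr fun j => ?_
  rw [map_mul, map_mul, pairing_conj, pairing_conj, KotheSpace.star_apply, Complex.conj_conj]
  ring

variable (hf) in
/-- The `*`-homomorphism `ξ ↦ ∑ⱼ ξⱼ ⟨·, fⱼ⟩ fⱼ` from `λ^∞(|f_k|_q)` to `L(s', s)`. -/
def diagHom : KotheSpace (normMatrix f hf) →⋆ₙₐ[ℂ] (SDual →L[ℂ] S) where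
  toFun := diag hf
  map_smul' := map_smul (diag hf)
  map_zero' := map_zero (diag hf)
  map_add' := map_add (diag hf)
  map_mul' := diag_mul
  map_star' := diag_star

/-! ### The diagonal operators as a closed `*`-subalgebra -/

theorem bddAbove_eigenvalues {x : SDual →L[ℂ] S} {c : ℕ → ℂ}
    (hc : ∀ j, x (incl (f j)) = c j • f j) (q : ℕ) :
    BddAbove (Set.range fun j => ‖c j‖ * (normMatrix f hf).entry j q) := by
  obtain ⟨C, -, hC⟩ := bound_of_clm x q 0
  refine ⟨C, ?_⟩
  rintro _ ⟨j, rfl⟩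
  simpa only [hc, S.wnorm_smul, hf.wnorm_incl, mul_one] using! hC (incl (f j)) ((f j).wmem _)

theorem mem_range_diag_iff {x : SDual →L[ℂ] S} :
    x ∈ Set.range (diag hf) ↔ (∀ j, ∃ c : ℂ, x (incl (f j)) = c • f j) ∧
      ∀ g : L2, (∀ j, pairing g (f j) = 0) → x (L2.toDual g) = 0 := by
  constructor
  · rintro ⟨ξ, rfl⟩
    exact ⟨fun j => ⟨ξ j, diag_apply_self ξ j⟩, fun g hg => diag_apply_of_orthogonal ξ hg⟩
  · rintro ⟨heig, hzero⟩
    choose c hc using heig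
    refine ⟨KotheSpace.mk c (bddAbove_eigenvalues hc), clm_ext_orthogonal f (fun j => ?_)
      fun g hg => ?_⟩
    · rw [diag_apply_self, KotheSpace.toSeq_mk, hc]
    · rw [hzero g hg]
      exact diag_apply_of_orthogonal _ hg

variable (hf) in
theorem isClosed_range_diag : IsClosed (Set.range (diag hf)) := by
  have hrange : Set.range (diag hf) =
      (⋂ j, {x | x (incl (f j)) = S.pairingCLM (incl (f j)) (x (incl (f j))) • f j}) ∩
      ⋂ g : {g : L2 // ∀ j, pairing g (f j) = 0}, {x | x (L2.toDual g.1) = 0} := by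
    ext x
    simp only [mem_range_diag_iff, hf.exists_eq_smul_iff, Set.mem_inter_iff, Set.mem_iInter,
      Set.mem_ofPred_eq, Subtype.forall]
  rw [hrange]
  refine (isClosed_iInter fun j => isClosed_eq (continuous_eval_const _) ?_).inter
    (isClosed_iInter fun g => isClosed_eq (continuous_eval_const _) continuous_const)
  exact ((S.pairingCLM _).continuous.comp (continuous_eval_const _)).smul continuous_const

variable (hf) in
theorem continuous_diag : Continuous (diag hf) := by
  refine continuous_of_continuousAt_zero (diag hf) ?_
  rw [ContinuousAt, map_zero, (ContinuousLinearMap.hasBasis_nhds_zero_of_basis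
    S.withSeminorms.hasBasis_zero_ball).tendsto_right_iff]
  rintro ⟨B, s, ε⟩ ⟨hB, hε⟩
  obtain ⟨r, C, hC₀, hC⟩ := exists_forall_norm_pairing_le hB
  have hsmall : ∀ q ∈ s, ∀ᶠ ξ in nhds (0 : KotheSpace (normMatrix f hf)),
      C * KotheSpace.seminorms _ (4 * (q + r + 1)) ξ * ∑' j, (wnorm 1 (f j) ^ 2)⁻¹ < ε := by
    intro q _
    have hcont : Continuous fun ξ : KotheSpace (normMatrix f hf) =>
        C * KotheSpace.seminorms _ (4 * (q + r + 1)) ξ * ∑' j, (wnorm 1 (f j) ^ 2)⁻¹ :=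
      (continuous_const.mul (KotheSpace.withSeminorms.continuous_seminorm _)).mul continuous_const
    refine (hcont.tendsto 0).eventually (gt_mem_nhds ?_)
    rwa [map_zero, mul_zero, zero_mul]
  filter_upwards [(Filter.eventually_all_finset s).2 hsmall] with ξ hξ η hη
  rw [Seminorm.mem_ball_zero]
  exact Seminorm.finset_sup_apply_lt hε fun q hq =>
    (wnorm_diagLin_le ξ hC₀ (fun j => hC η hη (f j)) q).trans_lt (hξ q hq)

variable (hf) in
theorem isInducing_diag : Topology.IsInducing (diag hf) := by
  rw [IsTopologicalAddGroup.isInducing_iff_nhds_zero]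
  refine le_antisymm ?_ ?_
  · simpa only [map_zero] using ((continuous_diag hf).tendsto 0).le_comap
  · rw [KotheSpace.withSeminorms.hasBasis_zero_ball.ge_iff]
    rintro ⟨s, ε⟩ hε
    have hball : (s.sup sNorm).ball 0 (ε / 2) ∈ nhds (0 : S) :=
      S.withSeminorms.hasBasis_zero_ball.mem_of_mem (i := (s, ε / 2)) (half_pos hε)
    refine ⟨_, ContinuousLinearMap.eventually_nhds_zero_mapsTo hf.isVonNBounded_range hball,
      fun ξ hξ => ?_⟩
    rw [Seminorm.mem_ball_zero]
    refine Seminorm.finset_sup_apply_lt hε fun q hq =>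
      (ciSup_le fun j => ?_).trans_lt (half_lt_self hε)
    have hj : diag hf ξ (incl (f j)) ∈ (s.sup sNorm).ball 0 (ε / 2) := hξ ⟨j, rfl⟩
    rw [Seminorm.mem_ball_zero, diag_apply_self] at hj
    simpa only [map_smul_eq_mul] using!
      (Seminorm.le_finset_sup_apply (p := sNorm) hq (x := ξ j • f j)).trans hj.le

variable (hf) in
theorem isClosedEmbedding_diagHom : Topology.IsClosedEmbedding (diagHom hf) :=
  ⟨⟨isInducing_diag hf, diag_injective⟩, isClosed_range_diag hf⟩

end Diagonal

/-! ### Closed `*`-subalgebras of Köthe–Schwartz algebras -/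

section Schwartz

open Filter Topology

/-- A Köthe matrix `(a_{j,q})` is *Schwartz* if every column is of smaller order than some other
column; this is the usual condition for `λ^∞(A)` to be a Schwartz space. -/
def KotheMatrix.IsSchwartz (A : KotheMatrix) : Prop :=
  ∀ q, ∃ r, (fun j => A.entry j q) =o[cofinite] fun j => A.entry j r

theorem isSchwartz_normMatrix {f : ℕ → S} (hf : OrthonormalSeq f) :
    (normMatrix f hf).IsSchwartz := by
  intro q
  have hle : ∀ j, wnorm q (f j) ≤ (wnorm 1 (f j) ^ 2)⁻¹ * wnorm (4 * (q + 0 + 1) : ℕ) (f j) :=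
    fun j => by
      have h := hf.wnorm_mul_wnorm_mul_le j q 0
      rw [Nat.cast_zero, hf.wnorm_zero, mul_one] at h
      exact (le_inv_mul_iff₀' (pow_pos (zero_lt_one.trans_le (hf.one_le j 1)) 2)).2 h
  refine ⟨4 * (q + 0 + 1), Asymptotics.isLittleO_iff.2 fun ε hε => ?_⟩
  filter_upwards [hf.summable_inv_wnorm_one_sq.tendsto_cofinite_zero.eventually_le_const hε]
    with j hj
  rw [Real.norm_of_nonneg ((normMatrix f hf).nonneg j _),
    Real.norm_of_nonneg ((normMatrix f hf).nonneg j _)]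
  exact (hle j).trans (mul_le_mul_of_nonneg_right hj (wnorm_nonneg _ _))

namespace KotheSpace

variable {A : KotheMatrix}

theorem tendsto_norm_mul_entry (hA : A.IsSchwartz) (ξ : KotheSpace A) (q : ℕ) :
    Tendsto (fun j => ‖ξ j‖ * A.entry j q) cofinite (𝓝 0) := by
  obtain ⟨r, hr⟩ := hA q
  have hbdd : (fun j => ‖ξ j‖ * A.entry j r) =O[cofinite] fun _ => (1 : ℝ) :=
    .of_bound (seminorms A r ξ) <| Eventually.of_forall fun j => by
      rw [Real.norm_of_nonneg (mul_nonneg (norm_nonneg _) (A.nonneg j r)), norm_one, mul_one]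
      exact le_iSup ξ r j
  exact (Asymptotics.isLittleO_one_iff ℝ).1
    (((Asymptotics.isBigO_refl _ _).mul_isLittleO hr).trans_isBigO hbdd)

theorem tendsto_of_dominated (hA : A.IsSchwartz) {ι : Type*} {l : Filter ι}
    {u : ι → KotheSpace A} {v : KotheSpace A} (ζ : KotheSpace A)
    (hζ : ∀ n j, ‖u n j - v j‖ ≤ ‖ζ j‖) (hlim : ∀ j, Tendsto (fun n => u n j) l (𝓝 (v j))) :
    Tendsto u l (𝓝 v) := by
  refine (withSeminorms.tendsto_nhds u v).2 fun q ε hε => ?_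
  have htail : {j | ¬ ‖ζ j‖ * A.entry j q < ε / 2}.Finite := eventually_cofinite.1
    ((tendsto_norm_mul_entry hA ζ q).eventually (gt_mem_nhds (half_pos hε)))
  have hhead : ∀ᶠ n in l, ∀ j ∈ {j | ¬ ‖ζ j‖ * A.entry j q < ε / 2},
      ‖u n j - v j‖ * A.entry j q < ε / 2 := by
    refine (eventually_all_finite htail).2 fun j _ => Tendsto.eventually_lt_const (half_pos hε) ?_
    simpa only [zero_mul] using
      (tendsto_iff_norm_sub_tendsto_zero.1 (hlim j)).mul_const (A.entry j q)
  filter_upwards [hhead] with n hn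
  refine (ciSup_le fun j => ?_).trans_lt (half_lt_self hε)
  rw [map_sub, Pi.sub_apply]
  by_cases hj : ‖ζ j‖ * A.entry j q < ε / 2
  · exact (mul_le_mul_of_nonneg_right (hζ n j) (A.nonneg j q)).trans hj.le
  · exact (hn j hj).le

variable (A) in
/-- The indicator function of a finite set, as an element of `λ^∞(A)`. -/
def ind (s : Finset ℕ) : KotheSpace A := ∑ j ∈ s, unit A j

theorem ind_apply (s : Finset ℕ) (i : ℕ) : ind A s i = if i ∈ s then 1 else 0 := by
  rw [ind, map_sum, Finset.sum_apply]
  change ∑ j ∈ s, (Pi.single j 1 : ℕ → ℂ) i = _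
  simp [Pi.single_apply]

theorem ind_injective : Function.Injective (ind A) := fun s t h => by
  ext j
  have hj := congrFun (congrArg toSeq h) j
  rw [ind_apply, ind_apply] at hj
  by_cases hs : j ∈ s <;> by_cases ht : j ∈ t <;> simp_all

theorem ind_empty : ind A ∅ = 0 := Finset.sum_empty

theorem ind_ne_zero_iff {s : Finset ℕ} : ind A s ≠ 0 ↔ s.Nonempty := by
  rw [Finset.nonempty_iff_ne_empty, ← ind_empty, ind_injective.ne_iff]

variable [A.OneLE]

theorem finite_setOf_le_norm (hA : A.IsSchwartz) (ξ : KotheSpace A) {ε : ℝ} (hε : 0 < ε) :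
    {j | ε ≤ ‖ξ j‖}.Finite := by
  refine (eventually_cofinite.1
    ((tendsto_norm_mul_entry hA ξ 0).eventually (gt_mem_nhds hε))).subset fun j hj => ?_
  exact not_lt.2 (le_trans hj (le_mul_of_one_le_right (norm_nonneg _)
    (KotheMatrix.OneLE.one_le j 0)))

theorem mul_ind_apply (ξ : KotheSpace A) (s : Finset ℕ) (j : ℕ) :
    (ξ * ind A s) j = if j ∈ s then ξ j else 0 := by
  rw [mul_apply, ind_apply, mul_ite, mul_one, mul_zero]

theorem isStarProjection_ind (s : Finset ℕ) : IsStarProjection (ind A s) where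
  isIdempotentElem := ext fun j => by
    rw [mul_ind_apply, ind_apply]
    split_ifs <;> rfl
  isSelfAdjoint := ext fun j => by
    rw [star_apply, ind_apply, apply_ite conj, map_one, map_zero]

theorem exists_eq_ind (hA : A.IsSchwartz) {P : KotheSpace A} (hP : IsStarProjection P) :
    ∃ s, P = ind A s := by
  have hP₀₁ : ∀ j, P j = 0 ∨ P j = 1 := fun j => by
    have hj : P j * P j = P j := congrFun (congrArg toSeq hP.isIdempotentElem.eq) j
    exact IsIdempotentElem.iff_eq_zero_or_one.1 hj
  refine ⟨(finite_setOf_le_norm hA P one_pos).toFinset, ext fun j => ?_⟩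
  rw [ind_apply]
  rcases hP₀₁ j with h | h <;> simp [h]

theorem ind_mul_ind_eq_iff {s t : Finset ℕ} : ind A s * ind A t = ind A s ↔ s ⊆ t := by
  refine ⟨fun h j hj => ?_, fun h => ext fun j => ?_⟩
  · have := congrFun (congrArg toSeq h) j
    rw [mul_ind_apply, ind_apply, if_pos hj] at this
    by_contra ht
    simp [ht] at this
  · rw [mul_ind_apply, ind_apply]
    have := @h j
    grind

theorem exists_norm_le_norm (hA : A.IsSchwartz) {ξ : KotheSpace A} (hξ : ξ ≠ 0) :
    ∃ a, ξ a ≠ 0 ∧ ∀ j, ‖ξ j‖ ≤ ‖ξ a‖ := by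
  obtain ⟨i, hi⟩ : ∃ i, ξ i ≠ 0 := by
    by_contra! h
    exact hξ (ext h)
  obtain ⟨a, ha, hmax⟩ := Set.exists_max_image _ (fun j => ‖ξ j‖)
    (finite_setOf_le_norm hA ξ (norm_pos_iff.2 hi)) ⟨i, le_refl ‖ξ i‖⟩
  refine ⟨a, norm_pos_iff.1 ((norm_pos_iff.2 hi).trans_le ha), fun j => ?_⟩
  rcases le_total ‖ξ i‖ ‖ξ j‖ with hj | hj
  · exact hmax j hj
  · exact hj.trans ha

variable {F : NonUnitalStarSubalgebra ℂ (KotheSpace A)}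

theorem exists_ind_mem_of_eq_one_or_norm_lt_one (hA : A.IsSchwartz)
    (hF : IsClosed (F : Set (KotheSpace A))) {η : KotheSpace A} (hη : η ∈ F)
    (hη₁ : ∀ j, η j = 1 ∨ ‖η j‖ < 1) : ∃ s, ind A s ∈ F ∧ ∀ j, j ∈ s ↔ η j = 1 := by
  have hs : ∀ j, j ∈ (finite_setOf_le_norm hA η one_pos).toFinset ↔ η j = 1 := fun j => by
    rw [Set.Finite.mem_toFinset, Set.mem_ofPred_eq]
    rcases hη₁ j with hj | hj
    · simp [hj]
    · exact iff_of_false hj.not_ge fun h => by simp [h] at hj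
  refine ⟨_, ?_, hs⟩
  -- the powers of `η` converge to the indicator function
  let u : ℕ → KotheSpace A := fun n => (· * η)^[n] η
  have hu : ∀ n j, u n j = η j ^ (n + 1) := fun n j => by
    induction n with
    | zero => exact (pow_one _).symm
    | succ n ih => rw [pow_succ, ← ih, ← mul_apply]; simp only [u, Function.iterate_succ_apply']
  have huF : ∀ n, u n ∈ F := fun n => by
    induction n with
    | zero => exact hη
    | succ n ih => simpa only [u, Function.iterate_succ_apply'] using mul_mem ih hη
  refine hF.mem_of_tendsto (tendsto_of_dominated hA (l := atTop) (u := u) η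
    (fun n j => ?_) fun j => ?_) (Eventually.of_forall huF)
  · rw [hu, ind_apply]
    rcases hη₁ j with hj | hj
    · simp [(hs j).2 hj, hj]
    · rw [if_neg fun h => by simp [(hs j).1 h] at hj, sub_zero, norm_pow]
      exact pow_le_of_le_one (norm_nonneg _) hj.le n.succ_ne_zero
  · simp only [hu, ind_apply]
    rcases hη₁ j with hj | hj
    · simp [(hs j).2 hj, hj]
    · rw [if_neg fun h => by simp [(hs j).1 h] at hj]
      exact (tendsto_pow_atTop_nhds_zero_of_norm_lt_one hj).comp (tendsto_add_atTop_nat 1)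

theorem exists_ind_peak_mem (hA : A.IsSchwartz) (hF : IsClosed (F : Set (KotheSpace A)))
    {ξ : KotheSpace A} (hξ : ξ ∈ F) (hξ₀ : ξ ≠ 0) :
    ∃ s, s.Nonempty ∧ ind A s ∈ F ∧ ∀ a ∈ s, ξ a ≠ 0 ∧ ∀ j, ‖ξ j‖ ≤ ‖ξ a‖ := by
  obtain ⟨a, ha, hmax⟩ := exists_norm_le_norm hA hξ₀
  have ha' : 0 < ‖ξ a‖ := norm_pos_iff.2 ha
  let η : KotheSpace A := (((‖ξ a‖ ^ 2)⁻¹ : ℝ) : ℂ) • (star ξ * ξ)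
  have hη : ∀ j, η j = (((‖ξ j‖ / ‖ξ a‖) ^ 2 : ℝ) : ℂ) := fun j => by
    change (((‖ξ a‖ ^ 2)⁻¹ : ℝ) : ℂ) * (conj (ξ j) * ξ j) = _
    rw [mul_comm (conj (ξ j)), Complex.mul_conj, Complex.normSq_eq_norm_sq, ← Complex.ofReal_mul,
      div_pow, div_eq_inv_mul]
  have hη_iff : ∀ j, η j = 1 ↔ ‖ξ j‖ = ‖ξ a‖ := fun j => by
    rw [hη, Complex.ofReal_eq_one, pow_eq_one_iff_of_nonneg (by positivity) two_ne_zero,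
      div_eq_one_iff_eq ha'.ne']
  obtain ⟨s, hsF, hs⟩ := exists_ind_mem_of_eq_one_or_norm_lt_one hA hF (η := η)
    (SMulMemClass.smul_mem _ (mul_mem (star_mem hξ) hξ)) fun j => by
      rw [hη_iff, or_iff_not_imp_left]
      intro hj
      rw [hη, Complex.norm_real, Real.norm_of_nonneg (by positivity)]
      exact pow_lt_one₀ (by positivity) ((div_lt_one ha').2 ((hmax j).lt_of_ne hj)) two_ne_zero
  refine ⟨s, ⟨a, (hs a).2 ((hη_iff a).2 rfl)⟩, hsF, fun b hb => ?_⟩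
  have hb' : ‖ξ b‖ = ‖ξ a‖ := (hη_iff b).1 ((hs b).1 hb)
  exact ⟨norm_pos_iff.1 (ha'.trans_eq hb'.symm), fun j => (hmax j).trans_eq hb'.symm⟩

theorem exists_isMinimalProjection_peak (hA : A.IsSchwartz)
    (hF : IsClosed (F : Set (KotheSpace A))) {ξ : KotheSpace A} (hξ : ξ ∈ F) (hξ₀ : ξ ≠ 0) :
    ∃ s, s.Nonempty ∧ IsMinimalProjection F (ind A s) ∧
      ∀ a ∈ s, ξ a ≠ 0 ∧ ∀ j, ‖ξ j‖ ≤ ‖ξ a‖ := by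
  obtain ⟨t, ht, htF, hpeak⟩ := exists_ind_peak_mem hA hF hξ hξ₀
  obtain ⟨s, ⟨hst, hs, hsF⟩, hmin⟩ := wellFounded_lt.has_min
    {s : Finset ℕ | s ⊆ t ∧ s.Nonempty ∧ ind A s ∈ F} ⟨t, subset_rfl, ht, htF⟩
  refine ⟨s, hs, ⟨hsF, isStarProjection_ind s, ind_ne_zero_iff.2 hs, ?_⟩,
    fun a ha => hpeak a (hst ha)⟩
  intro Q hQ hQP hQ₀ hQs
  obtain ⟨r, rfl⟩ := exists_eq_ind hA hQP
  have hrs : r ⊆ s := ind_mul_ind_eq_iff.1 hQs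
  rw [hrs.eq_of_not_ssubset (hmin r ⟨hrs.trans hst, ind_ne_zero_iff.1 hQ₀, hQ⟩)]

theorem exists_mul_ind_eq_smul (hA : A.IsSchwartz) (hF : IsClosed (F : Set (KotheSpace A)))
    {s : Finset ℕ} (hs : IsMinimalProjection F (ind A s)) {ξ : KotheSpace A} (hξ : ξ ∈ F) :
    ∃ c : ℂ, ξ * ind A s = c • ind A s := by
  obtain ⟨a, ha⟩ := ind_ne_zero_iff.1 hs.ne_zero
  refine ⟨ξ a, by_contra fun hne => ?_⟩
  obtain ⟨t, ht, htF, htζ⟩ := exists_ind_peak_mem hA hF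
    (sub_mem (mul_mem hξ hs.mem) (SMulMemClass.smul_mem (ξ a) hs.mem)) (sub_ne_zero.2 hne)
  have hζ : ∀ j, (ξ * ind A s - ξ a • ind A s) j = if j ∈ s then ξ j - ξ a else 0 := fun j => by
    change (ξ * ind A s) j - ξ a * ind A s j = _
    rw [mul_ind_apply, ind_apply]
    split_ifs <;> simp
  have hts : t ⊆ s := fun j hj => by
    by_contra hjs
    exact (htζ j hj).1 (by rw [hζ, if_neg hjs])
  have hat : a ∉ t := fun h => (htζ a h).1 (by rw [hζ, if_pos ha, sub_self])
  have hst : t = s := ind_injective <| hs.eq_of_le _ htF (isStarProjection_ind t)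
    (ind_ne_zero_iff.2 ht) (ind_mul_ind_eq_iff.2 hts)
  exact hat (hst ▸ ha)

theorem exists_mul_ind_mem (hA : A.IsSchwartz) (hF : IsClosed (F : Set (KotheSpace A)))
    {G : NonUnitalStarSubalgebra ℂ (KotheSpace A)} (hG : ∀ P, IsMinimalProjection F P → P ∈ G)
    {ξ : KotheSpace A} (hξ : ξ ∈ F) {ε : ℝ} (hε : 0 < ε) :
    ∃ s, ξ * ind A s ∈ G ∧ ∀ j, ε ≤ ‖ξ j‖ → j ∈ s := by
  let L := (finite_setOf_le_norm hA ξ hε).toFinset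
  have hL : ∀ j, j ∈ L ↔ ε ≤ ‖ξ j‖ := fun j => Set.Finite.mem_toFinset _
  obtain ⟨s, ⟨hsF, hsG⟩, hmin⟩ := (measure fun s => (L \ s).card).wf.has_min
    {s | ind A s ∈ F ∧ ξ * ind A s ∈ G}
    ⟨∅, by rw [ind_empty]; exact zero_mem F, by rw [ind_empty, mul_zero]; exact zero_mem G⟩
  refine ⟨s, hsG, fun j hj => by_contra fun hjs => ?_⟩
  have hζ : ∀ i, (ξ - ξ * ind A s) i = if i ∈ s then 0 else ξ i := fun i => by
    rw [map_sub, Pi.sub_apply, mul_ind_apply]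
    split_ifs <;> simp
  have hζ₀ : ξ - ξ * ind A s ≠ 0 := fun h => by
    have := hζ j
    rw [h, if_neg hjs, map_zero, Pi.zero_apply] at this
    simp [← this] at hj
    linarith
  obtain ⟨t, ⟨b, hb⟩, htmin, hpeak⟩ :=
    exists_isMinimalProjection_peak hA hF (sub_mem hξ (mul_mem hξ hsF)) hζ₀
  have hts : ∀ i ∈ t, i ∉ s := fun i hi his => (hpeak i hi).1 ((hζ i).trans (if_pos his))
  have hbL : b ∈ L := (hL b).2 <| hj.trans <| by
    simpa only [hζ, if_neg hjs, if_neg (hts b hb)] using (hpeak b hb).2 j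
  have hadd : ind A (s ∪ t) = ind A s + ind A t :=
    Finset.sum_union (Finset.disjoint_right.2 @hts)
  obtain ⟨c, hc⟩ := exists_mul_ind_eq_smul hA hF htmin hξ
  refine hmin (s ∪ t) ⟨?_, ?_⟩ (Finset.card_lt_card ?_)
  · rw [hadd]
    exact add_mem hsF htmin.mem
  · rw [hadd, mul_add, hc]
    exact add_mem hsG (SMulMemClass.smul_mem c (hG _ htmin))
  · refine Finset.ssubset_iff_of_subset (by gcongr; exact Finset.subset_union_left) |>.2
      ⟨b, Finset.mem_sdiff.2 ⟨hbL, hts b hb⟩, ?_⟩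
    simp [hb]

theorem closedAdjoin_minimalProjections (hA : A.IsSchwartz)
    (hF : IsClosed (F : Set (KotheSpace A))) :
    closedAdjoin {P | IsMinimalProjection F P} = F := by
  refine le_antisymm (closedAdjoin_le hF fun P hP => hP.mem) fun ξ hξ => ?_
  choose s hsG hs using fun n : ℕ => exists_mul_ind_mem hA hF
    (fun P hP => subset_closedAdjoin {P | IsMinimalProjection F P} hP) hξ
    (Nat.one_div_pos_of_nat (α := ℝ) (n := n))
  refine (isClosed_closedAdjoin _).mem_of_tendsto
    (tendsto_of_dominated hA (l := atTop) (u := fun n => ξ * ind A (s n)) ξ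
      (fun n j => ?_) fun j => ?_)
    (Eventually.of_forall hsG)
  · rw [mul_ind_apply]
    split_ifs <;> simp
  · refine tendsto_const_nhds.congr' ?_
    rcases eq_or_ne (ξ j) 0 with hj | hj
    · exact Eventually.of_forall fun n => by simp only [mul_ind_apply, hj, ite_self]
    · filter_upwards [(tendsto_one_div_add_atTop_nhds_zero_nat (𝕜 := ℝ)).eventually_lt_const
        (norm_pos_iff.2 hj)] with n hn
      rw [mul_ind_apply, if_pos (hs n j hn.le)]

end KotheSpace

end Schwartz

/-! ### Commutative `*`-subalgebras of `L(s', s)` -/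

theorem not_finite_S : ¬ Module.Finite ℂ S := fun _ =>
  have hunit : LinearIndependent ℂ S.unit :=
    .of_comp S.toSeq (Pi.linearIndependent_single_one ℕ ℂ)
  not_finite_iff_infinite.2 (inferInstance : Infinite ℕ) hunit.finite

/-- The vectors of `s` that are eigenvectors of every operator of `E`. -/
def jointEigenvectors (E : NonUnitalStarSubalgebra ℂ (SDual →L[ℂ] S)) : Set S :=
  {u | ∀ x ∈ E, ∃ c : ℂ, x (incl u) = c • u}

section Commutative

variable {E : NonUnitalStarSubalgebra ℂ (SDual →L[ℂ] S)}

theorem toL2_mem_image_jointEigenvectors {g : L2} (hg : ∀ x ∈ E, ∃ c : ℂ, hat x g = c • g)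
    (hg₀ : ∃ x ∈ E, hat x g ≠ 0) : g ∈ S.toL2 '' jointEigenvectors E := by
  obtain ⟨x, hx, hxg⟩ := hg₀
  obtain ⟨c, hc⟩ := hg x hx
  have hc₀ : c ≠ 0 := fun h => hxg (by rw [hc, h, zero_smul])
  -- `g` is the image under `x` of a multiple of itself, hence lies in `s`
  have hu : S.toL2 (c⁻¹ • x (L2.toDual g)) = g := by
    rw [map_smul, ← hat_apply, hc, inv_smul_smul₀ hc₀]
  refine ⟨_, fun y hy => ?_, hu⟩
  obtain ⟨d, hd⟩ := hg y hy
  refine ⟨d, S.toL2_injective ?_⟩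
  rw [← hat_toL2, hu, hd, map_smul _ d, hu]

theorem exists_orthonormal_subset_jointEigenvectors (hE : ∀ x ∈ E, ∀ y ∈ E, x * y = y * x) :
    ∃ V ⊆ S.toL2 '' jointEigenvectors E, Orthonormal ℂ ((↑) : V → L2) ∧
      (∀ u ∈ jointEigenvectors E, (∀ v ∈ V, inner ℂ v (S.toL2 u) = 0) → u = 0) ∧
      ∀ x ∈ E, ∀ g, (∀ v ∈ V, inner ℂ v g = 0) → x (L2.toDual g) = 0 := by
  obtain ⟨V, hVP, hVo, hmax, hzero⟩ := exists_orthonormal_jointEigenvectors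
    (𝒜 := hat '' (E : Set (SDual →L[ℂ] S))) (P := S.toL2 '' jointEigenvectors E)
    (by rintro _ ⟨x, -, rfl⟩; exact isCompactOperator_hat x)
    (by
      rintro _ ⟨x, hx, rfl⟩ _ ⟨y, hy, rfl⟩
      exact Commute.map (hE x hx y hy) hat)
    (by rintro _ ⟨x, hx, rfl⟩; exact ⟨star x, star_mem hx, map_star hat x⟩)
    (by
      rintro a _ ⟨u, hu, rfl⟩
      refine ⟨a • u, fun x hx => ?_, map_smul _ a u⟩
      obtain ⟨c, hc⟩ := hu x hx
      exact ⟨c, by rw [map_smul, map_smul, hc, smul_comm]⟩)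
    (by
      rintro _ ⟨u, hu, rfl⟩ _ ⟨x, hx, rfl⟩
      obtain ⟨c, hc⟩ := hu x hx
      exact ⟨c, by rw [hat_toL2, hc, map_smul]⟩)
    (fun g hg ⟨_, ⟨x, hx, hA⟩, hxg⟩ => toL2_mem_image_jointEigenvectors
      (fun y hy => hg _ ⟨y, hy, rfl⟩) ⟨x, hx, hA ▸ hxg⟩)
  refine ⟨V, hVP, hVo, fun u hu huV => ?_, fun x hx g hg => ?_⟩
  · exact (map_eq_zero_iff S.toL2 S.toL2_injective).1 (hmax _ ⟨u, hu, rfl⟩ huV)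
  · exact (map_eq_zero_iff S.toL2 S.toL2_injective).1 (hzero _ ⟨x, hx, rfl⟩ g hg)

theorem exists_subset_range_diag (hE : ∀ x ∈ E, ∀ y ∈ E, x * y = y * x) :
    ∃ (f : ℕ → S) (hf : OrthonormalSeq f), (E : Set (SDual →L[ℂ] S)) ⊆ Set.range (diag hf) := by
  obtain ⟨V, hVP, hVo, hmax, hzero⟩ := exists_orthonormal_subset_jointEigenvectors hE
  have hinf : V.Infinite := fun hfin => by
    obtain ⟨u, hu₀, hu⟩ := exists_ne_zero_forall_inner_eq_zero not_finite_S S.toL2 hfin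
    exact hu₀ <| hmax u (fun x hx => ⟨0, by rw [zero_smul]; exact hzero x hx _ hu⟩) hu
  have hcount : Countable V := countable_of_orthonormal hVo (S.toL2 ∘ S.unit) fun g hg =>
    Subtype.ext <| funext fun j => (pairing_single_right g j).symm.trans <|
      (pairing_eq_inner g _).trans <| inner_eq_zero_symm.1 (hg j)
  have := hinf.to_subtype
  obtain ⟨e⟩ : Nonempty (ℕ ≃ V) := nonempty_equiv_of_countable
  choose f hfE hfV using fun n => hVP (e n).2
  have hf : OrthonormalSeq f := orthonormalSeq_iff.2 <| by
    simpa only [hfV] using! hVo.comp e e.injective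
  refine ⟨f, hf, fun x hx => mem_range_diag_iff.2 ⟨fun j => hfE j x hx, fun g hg => ?_⟩⟩
  refine hzero x hx g fun v hv => ?_
  obtain ⟨n, hn⟩ := e.surjective ⟨v, hv⟩
  have hv' : S.toL2 (f n) = v := (hfV n).trans (congrArg Subtype.val hn)
  rw [← hv', ← pairing_eq_inner]
  exact hg n

theorem exists_map_diagHom_eq (hEc : IsClosed (E : Set (SDual →L[ℂ] S)))
    (hE : ∀ x ∈ E, ∀ y ∈ E, x * y = y * x) :
    ∃ (f : ℕ → S) (hf : OrthonormalSeq f)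
      (F : NonUnitalStarSubalgebra ℂ (KotheSpace (normMatrix f hf))),
      IsClosed (F : Set (KotheSpace (normMatrix f hf))) ∧ F.map (diagHom hf) = E := by
  obtain ⟨f, hf, hEf⟩ := exists_subset_range_diag hE
  exact ⟨f, hf, E.comap (diagHom hf), hEc.preimage (isClosedEmbedding_diagHom hf).continuous,
    SetLike.coe_injective (Set.image_preimage_eq_of_subset hEf)⟩

theorem closedAdjoin_isMinimalProjection (hEc : IsClosed (E : Set (SDual →L[ℂ] S)))
    (hE : ∀ x ∈ E, ∀ y ∈ E, x * y = y * x) : closedAdjoin {P | IsMinimalProjection E P} = E := by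
  obtain ⟨f, hf, F, hF, rfl⟩ := exists_map_diagHom_eq hEc hE
  have hφ := isClosedEmbedding_diagHom hf
  rw [setOf_isMinimalProjection_map hφ.injective, ← map_closedAdjoin hφ.continuous hφ.isClosedMap,
    KotheSpace.closedAdjoin_minimalProjections (isSchwartz_normMatrix hf) hF]

end Commutative

/-! ### The canonical Schauder basis -/

theorem diagHom_ind {f : ℕ → S} (hf : OrthonormalSeq f) (s : Finset ℕ) :
    diagHom hf (KotheSpace.ind _ s) = ∑ j ∈ s, rankOne (f j) := by
  rw [KotheSpace.ind, map_sum]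
  exact Finset.sum_congr rfl fun j _ => diag_unit j

theorem map_diagHom_closedAdjoin_ind {E : NonUnitalStarSubalgebra ℂ (SDual →L[ℂ] S)}
    (hEc : IsClosed (E : Set (SDual →L[ℂ] S))) (hE : ∀ x ∈ E, ∀ y ∈ E, x * y = y * x)
    {f : ℕ → S} (hf : OrthonormalSeq f) {N : ℕ → Finset ℕ}
    (hN : IsCanonicalBasis E fun k => ∑ j ∈ N k, rankOne (f j)) :
    (closedAdjoin (Set.range fun k => KotheSpace.ind (normMatrix f hf) (N k))).map (diagHom hf)
      = E := by
  have hφ := isClosedEmbedding_diagHom hf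
  rw [map_closedAdjoin hφ.continuous hφ.isClosedMap, ← Set.range_comp]
  simp only [Function.comp_def, diagHom_ind]
  rw [hN.range_eq, closedAdjoin_isMinimalProjection hEc hE]

end SmoothOp

end

theorem mainTheorem4 :
    -- every closed commutative `*`-subalgebra of `L(s', s)`
    (∀ E : NonUnitalStarSubalgebra ℂ (SmoothOp.SDual →L[ℂ] SmoothOp.S),
      IsClosed (E : Set (SmoothOp.SDual →L[ℂ] SmoothOp.S)) →
      (∀ x ∈ E, ∀ y ∈ E, x * y = y * x) →
      ∃ (f : ℕ → SmoothOp.S) (hf : SmoothOp.OrthonormalSeq f)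
        (F : NonUnitalStarSubalgebra ℂ (SmoothOp.KotheSpace (SmoothOp.normMatrix f hf))),
        IsClosed (F : Set (SmoothOp.KotheSpace (SmoothOp.normMatrix f hf))) ∧
        SmoothOp.FrechetIso E F) ∧
    -- the explicit form for infinite-dimensional algebras
    (∀ E : NonUnitalStarSubalgebra ℂ (SmoothOp.SDual →L[ℂ] SmoothOp.S),
      IsClosed (E : Set (SmoothOp.SDual →L[ℂ] SmoothOp.S)) →
      (∀ x ∈ E, ∀ y ∈ E, x * y = y * x) →
      ¬ FiniteDimensional ℂ E →
      ∀ (f : ℕ → SmoothOp.S) (hf : SmoothOp.OrthonormalSeq f) (N : ℕ → Finset ℕ),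
        (∀ k l, k ≠ l → Disjoint (N k) (N l)) →
        ∀ hE : SmoothOp.IsCanonicalBasis E
          (fun k => ∑ j ∈ N k, SmoothOp.rankOne (f j)),
        ∃ Φ : E ≃⋆ₐ[ℂ] (SmoothOp.closedAdjoin (Set.range fun k =>
            ∑ j ∈ N k, SmoothOp.KotheSpace.unit (SmoothOp.normMatrix f hf) j)),
          Continuous Φ ∧ Continuous Φ.symm ∧
          ∀ k, (Φ ⟨∑ j ∈ N k, SmoothOp.rankOne (f j), hE.mem k⟩ :
              SmoothOp.KotheSpace (SmoothOp.normMatrix f hf)) =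
            ∑ j ∈ N k, SmoothOp.KotheSpace.unit (SmoothOp.normMatrix f hf) j) ∧
    -- the converse
    (∀ (f : ℕ → SmoothOp.S) (hf : SmoothOp.OrthonormalSeq f)
      (F : NonUnitalStarSubalgebra ℂ (SmoothOp.KotheSpace (SmoothOp.normMatrix f hf))),
      IsClosed (F : Set (SmoothOp.KotheSpace (SmoothOp.normMatrix f hf))) →
      ∃ E : NonUnitalStarSubalgebra ℂ (SmoothOp.SDual →L[ℂ] SmoothOp.S),
        IsClosed (E : Set (SmoothOp.SDual →L[ℂ] SmoothOp.S)) ∧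
        (∀ x ∈ E, ∀ y ∈ E, x * y = y * x) ∧
        SmoothOp.FrechetIso E F) := by
  refine ⟨fun E hEc hE => ?_, fun E hEc hE _ f hf N _ hN => ?_, fun f hf F hF => ?_⟩
  · obtain ⟨f, hf, F, hF, rfl⟩ := SmoothOp.exists_map_diagHom_eq hEc hE
    exact ⟨f, hf, F, hF,
      (SmoothOp.frechetIso_map (SmoothOp.isClosedEmbedding_diagHom hf).isEmbedding F).symm⟩
  · have hφ := (SmoothOp.isClosedEmbedding_diagHom hf).isEmbedding
    obtain rfl := SmoothOp.map_diagHom_closedAdjoin_ind hEc hE hf hN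
    exact ⟨(SmoothOp.mapEquiv hφ.injective _).symm, SmoothOp.continuous_mapEquiv_symm hφ _,
      SmoothOp.continuous_mapEquiv hφ _,
      fun k => SmoothOp.coe_mapEquiv_symm_eq hφ.injective (SmoothOp.diagHom_ind hf (N k))⟩
  · have hφ := SmoothOp.isClosedEmbedding_diagHom hf
    exact ⟨F.map (SmoothOp.diagHom hf), hφ.isClosedMap _ hF, SmoothOp.commute_of_mem_map,
      (SmoothOp.frechetIso_map hφ.isEmbedding F).symm⟩
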